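/- Let $\mathcal H$ be a separable real Hilbert space and $\mu_0=N(m_0,C_0)$ a Gaussian measure on $\mathcal H$ with strictly positive covariance operator $C_0$. Let $\mathcal H^1=C_0^{1/2}\mathcal H$ be its Cameron–Martin space, with scalar product $\langle C_0^{-1/2}\cdot,C_0^{-1/2}\cdot\rangle$, and $\mathcal H^{-1}=(\mathcal H^1)^\star$. Let $X\subseteq\mathcal H$ be a separable Banach space, continuously embedded in $\mathcal H$, Borel measurable in $\mathcal H$, with $\mu_0(X)=1$. Let $\Phi:X\to\mathbb R$ be continuous with $e^{-\Phi}$ integrable with respect to $\mu_0$, and let $\mu$ be the probability measure $$\frac{d\mu}{d\mu_0}=\frac1{Z_\mu}e^{-\Phi},\qquad Z_\mu=\int e^{-\Phi}\,d\mu_0 .$$ For $m\in\mathcal H$ and a Hilbert–Schmidt operator $\Gamma\in\mathcal{HS}(\mathcal H^1,\mathcal H^{-1})$, regard $C_0^{-1}+\Gamma$ as an operator from $\mathcal H^1$ to $\mathcal H^{-1}$. If it is strictly positive, i.e. the form $Q_\Gamma(u,v)=\langle C_0^{-1/2}u,C_0^{-1/2}v\rangle+\langle u,\Gamma v\rangle$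 on $\mathcal H^1$ is symmetric and $Q_\Gamma(u,u)>0$ for all $u\neq0$, let $N_{P,0}(m,\Gamma)$ be the Gaussian measure on $\mathcal H$ with mean $m$ and covariance operator $(C_0^{-1}+\Gamma)^{-1}$; otherwise let $N_{P,0}(m,\Gamma)=\delta_m$. **Theorem.** Let $m_n\in\mathcal H$, $\Gamma_n\in\mathcal{HS}(\mathcal H^1,\mathcal H^{-1})$ and $\nu_n=N_{P,0}(m_n,\Gamma_n)$, $n\in\mathbb N$. Suppose that $\nu_n$ converges weakly to a probability measure $\nu_\star$ on $\mathcal H$, that $D_{\mathrm{KL}}(\nu_\star\|\mu)<\infty$, and that $$D_{\mathrm{KL}}(\nu_n\|\mu)\to D_{\mathrm{KL}}(\nu_\star\|\mu).$$ Then there are $m_\star\in\mathcal H$ and $\Gamma_\star\in\mathcal{HS}(\mathcal H^1,\mathcal H^{-1})$ with $\nu_\star=N_{P,0}(m_\star,\Gamma_\star)$ and $$\|m_n-m_\star\|_{\mathcal H^1}+\|\Gamma_n-\Gamma_\star\|_{\mathcal{HS}(\mathcal H^1,\mathcal H^{-1})}\to0,$$ where $\|x\|_{\mathcal H^1}=\infty$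 for $x\in\mathcal H\setminus\mathcal H^1$ (so that in particular $m_n-m_\star\in\mathcal H^1$ for all large $n$). -/

import Mathlib

open MeasureTheory ProbabilityTheory Filter Topology
open scoped ENNReal RealInnerProductSpace

noncomputable section

namespace GaussianKL

section SquareRoot

/-- Coefficients of the power series `1 - √(1 - t) = ∑ a k * t ^ (k + 1)`. -/
def sqrtCoeff (k : ℕ) : ℝ := (catalan k : ℝ) / (2 * 4 ^ k)

lemma sqrtCoeff_nonneg (k : ℕ) : 0 ≤ sqrtCoeff k := by
  unfold sqrtCoeff; positivity

lemma sqrtCoeff_zero : sqrtCoeff 0 = 1 / 2 := by simp [sqrtCoeff]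

lemma sqrtCoeff_succ (k : ℕ) :
    sqrtCoeff (k + 1)
      = 1 / 2 * ∑ p ∈ Finset.HasAntidiagonal.antidiagonal k, sqrtCoeff p.1 * sqrtCoeff p.2 := by
  have h : ∀ p ∈ Finset.HasAntidiagonal.antidiagonal k, sqrtCoeff p.1 * sqrtCoeff p.2
      = ((catalan p.1 * catalan p.2 : ℕ) : ℝ) * (1 / (4 * 4 ^ k)) := by
    intro p hp
    rw [Finset.HasAntidiagonal.mem_antidiagonal] at hp
    rw [← hp, pow_add]
    unfold sqrtCoeff
    push_cast
    field_simp
    ring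
  rw [Finset.sum_congr rfl h, ← Finset.sum_mul, ← Nat.cast_sum, ← catalan_succ']
  unfold sqrtCoeff
  rw [pow_succ]
  field_simp

lemma sum_sqrtCoeff_le (N : ℕ) : ∑ k ∈ Finset.range N, sqrtCoeff k ≤ 1 := by
  induction N with
  | zero => simp
  | succ N ih =>
    have h0 : 0 ≤ ∑ k ∈ Finset.range N, sqrtCoeff k :=
      Finset.sum_nonneg fun k _ => sqrtCoeff_nonneg k
    have h1 : ∑ k ∈ Finset.range N, ∑ p ∈ Finset.HasAntidiagonal.antidiagonal k, sqrtCoeff p.1 * sqrtCoeff p.2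
        ≤ (∑ k ∈ Finset.range N, sqrtCoeff k) * ∑ k ∈ Finset.range N, sqrtCoeff k := by
      rw [Finset.sum_mul_sum, ← Finset.sum_product', ← Finset.sum_biUnion]
      · refine Finset.sum_le_sum_of_subset_of_nonneg (fun p hp => ?_) fun p _ _ =>
          mul_nonneg (sqrtCoeff_nonneg _) (sqrtCoeff_nonneg _)
        simp only [Finset.mem_biUnion, Finset.mem_range, Finset.HasAntidiagonal.mem_antidiagonal] at hp
        obtain ⟨k, hk, hp⟩ := hp
        simp only [Finset.mem_product, Finset.mem_range]
        omega
      · intro i _ j _ hij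
        rw [Function.onFun, Finset.disjoint_left]
        intro p hp hp'
        rw [Finset.HasAntidiagonal.mem_antidiagonal] at hp hp'
        exact hij (hp.symm.trans hp')
    rw [Finset.sum_range_succ', sqrtCoeff_zero]
    simp_rw [sqrtCoeff_succ]
    rw [← Finset.mul_sum]
    nlinarith

lemma summable_sqrtCoeff : Summable sqrtCoeff :=
  summable_of_sum_range_le sqrtCoeff_nonneg sum_sqrtCoeff_le

lemma tsum_sqrtCoeff_le : ∑' k, sqrtCoeff k ≤ 1 :=
  Real.tsum_le_of_sum_range_le sqrtCoeff_nonneg sum_sqrtCoeff_le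

variable {H : Type*} [NormedAddCommGroup H] [InnerProductSpace ℝ H] [CompleteSpace H]

/-- Square roots of positive operators of norm at most one. -/
lemma exists_sqrt_of_norm_le_one {T : H →L[ℝ] H} (hT : T.IsPositive) (h1 : ‖T‖ ≤ 1) :
    ∃ S : H →L[ℝ] H, S.IsPositive ∧ S ∘L S = T := by
  set x : H →L[ℝ] H := 1 - T with hx
  have hsym : ∀ u v : H, ⟪T u, v⟫ = ⟪u, T v⟫ := fun u v => hT.1 u v
  have hpos : ∀ u : H, 0 ≤ ⟪T u, u⟫ := fun u => hT.2 u
  have hTv : ∀ v : H, ‖T v‖ ≤ ‖v‖ := fun v => by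
    simpa using (T.le_of_opNorm_le h1 v)
  have hxn : ‖x‖ ≤ 1 := by
    refine ContinuousLinearMap.opNorm_le_bound _ zero_le_one fun v => ?_
    rw [one_mul]
    have e1 := hpos (v - T v)
    have e2 : ⟪T (T v), T v⟫ ≤ ‖T v‖ ^ 2 := by
      calc ⟪T (T v), T v⟫ ≤ ‖T (T v)‖ * ‖T v‖ := real_inner_le_norm _ _
        _ ≤ ‖T v‖ * ‖T v‖ := by gcongr; exact hTv _
        _ = _ := by ring
    have e3 : ⟪T (v - T v), v - T v⟫ = ⟪T v, v⟫ - 2 * ‖T v‖ ^ 2 + ⟪T (T v), T v⟫ := by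
      rw [map_sub, inner_sub_left, inner_sub_right, inner_sub_right, hsym (T v) v,
        real_inner_self_eq_norm_sq]
      ring
    have e4 : ‖x v‖ ^ 2 = ‖v‖ ^ 2 - 2 * ⟪T v, v⟫ + ‖T v‖ ^ 2 := by
      have : x v = v - T v := by simp [hx]
      rw [this, norm_sub_sq_real, real_inner_comm]
    have e5 : ‖x v‖ ^ 2 ≤ ‖v‖ ^ 2 := by
      have := hpos v
      nlinarith
    exact le_of_sq_le_sq e5 (norm_nonneg _)
  have hxs : IsSelfAdjoint x :=
    (IsSelfAdjoint.one _).sub (ContinuousLinearMap.isSelfAdjoint_iff_isSymmetric.2 hT.1)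
  have hterm : ∀ k, ‖sqrtCoeff k • x ^ (k + 1)‖ ≤ sqrtCoeff k := fun k => by
    rw [norm_smul, Real.norm_of_nonneg (sqrtCoeff_nonneg k)]
    have : ‖x ^ (k + 1)‖ ≤ 1 := (norm_pow_le' x k.succ_pos).trans (pow_le_one₀ (norm_nonneg _) hxn)
    exact mul_le_of_le_one_right (sqrtCoeff_nonneg k) this
  have hsn : Summable fun k => ‖sqrtCoeff k • x ^ (k + 1)‖ :=
    Summable.of_nonneg_of_le (fun _ => norm_nonneg _) hterm summable_sqrtCoeff
  have hs : Summable fun k => sqrtCoeff k • x ^ (k + 1) := hsn.of_norm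
  set y : H →L[ℝ] H := ∑' k, sqrtCoeff k • x ^ (k + 1) with hy
  have hyn : ‖y‖ ≤ 1 :=
    (norm_tsum_le_tsum_norm hsn).trans
      ((hsn.tsum_le_tsum hterm summable_sqrtCoeff).trans tsum_sqrtCoeff_le)
  have hys : IsSelfAdjoint y := by
    rw [IsSelfAdjoint, hy, tsum_star]
    congr 1
    ext1 k
    rw [star_smul, star_pow, hxs.star_eq, star_trivial]
  have hyy : y * y = 2 • y - x := by
    have h2 : y * y = ∑' k, (2 * sqrtCoeff (k + 1)) • x ^ (k + 2) := by
      rw [hy, tsum_mul_tsum_eq_tsum_sum_antidiagonal_of_summable_norm hsn hsn]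
      congr 1
      ext1 k
      rw [sqrtCoeff_succ, ← mul_assoc, mul_one_div_cancel two_ne_zero, one_mul, Finset.sum_smul]
      refine Finset.sum_congr rfl fun p hp => ?_
      rw [Finset.HasAntidiagonal.mem_antidiagonal] at hp
      rw [smul_mul_smul_comm, ← pow_add, ← hp]
      congr 2
      ring
    have h3 : y = (1 / 2 : ℝ) • x + ∑' k, sqrtCoeff (k + 1) • x ^ (k + 2) := by
      rw [hy, hs.tsum_eq_zero_add, sqrtCoeff_zero]
      simp
    have h4 : y * y = (2 : ℝ) • ∑' k, sqrtCoeff (k + 1) • x ^ (k + 2) := by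
      rw [h2, ← tsum_const_smul'']
      simp_rw [smul_smul]
    have h5 : (2 : ℕ) • y = (2 : ℝ) • y := by rw [two_smul, two_smul]
    rw [h4, h5]
    nth_rewrite 1 [h3]
    rw [smul_add, smul_smul]
    norm_num
  refine ⟨1 - y, ⟨?_, fun v => ?_⟩, ?_⟩
  · exact ContinuousLinearMap.isSelfAdjoint_iff_isSymmetric.1 ((IsSelfAdjoint.one _).sub hys)
  · have e1 : ⟪y v, v⟫ ≤ ‖v‖ * ‖v‖ :=
      (real_inner_le_norm _ _).trans
        (mul_le_mul_of_nonneg_right (by simpa using y.le_of_opNorm_le hyn v) (norm_nonneg _))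
    have e2 : ⟪(1 - y) v, v⟫ = ‖v‖ * ‖v‖ - ⟪y v, v⟫ := by
      simp [inner_sub_left, pow_two]
    change 0 ≤ ⟪(1 - y) v, v⟫
    linarith
  · change (1 - y) * (1 - y) = T
    have : (1 - y) * (1 - y) = 1 - 2 • y + y * y := by noncomm_ring
    rw [this, hyy, hx]
    abel

/-- Every positive operator on a real Hilbert space has a positive square root. -/
theorem exists_sqrt {T : H →L[ℝ] H} (hT : T.IsPositive) :
    ∃ S : H →L[ℝ] H, S.IsPositive ∧ S ∘L S = T := by
  by_cases h0 : T = 0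
  · exact ⟨0, ContinuousLinearMap.isPositive_zero, by simp [h0]⟩
  have hn : 0 < ‖T‖ := norm_pos_iff.2 h0
  obtain ⟨S, hS, hSS⟩ := exists_sqrt_of_norm_le_one (T := ‖T‖⁻¹ • T)
    (hT.smul_of_nonneg (by positivity))
    (by rw [norm_smul, norm_inv, norm_norm, inv_mul_cancel₀ hn.ne'])
  refine ⟨√‖T‖ • S, hS.smul_of_nonneg (Real.sqrt_nonneg _), ?_⟩
  rw [ContinuousLinearMap.smul_comp, ContinuousLinearMap.comp_smul, hSS, smul_smul, smul_smul,
    Real.mul_self_sqrt hn.le, mul_inv_cancel₀ hn.ne', one_smul]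

/-- The positive square root `T^{1/2}` of a positive operator on a real Hilbert space. -/
def posSqrt (T : H →L[ℝ] H) (hT : T.IsPositive) : H →L[ℝ] H :=
  Classical.choose (exists_sqrt hT)

theorem posSqrt_isPositive {T : H →L[ℝ] H} (hT : T.IsPositive) : (posSqrt T hT).IsPositive :=
  (Classical.choose_spec (exists_sqrt hT)).1

theorem posSqrt_comp_self {T : H →L[ℝ] H} (hT : T.IsPositive) :
    posSqrt T hT ∘L posSqrt T hT = T :=
  (Classical.choose_spec (exists_sqrt hT)).2

end SquareRoot

section HilbertSchmidt

variable {E F : Type*} [NormedAddCommGroup E] [InnerProductSpace ℝ E]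
  [NormedAddCommGroup F] [NormedSpace ℝ F]

/-- The Hilbert–Schmidt norm `(∑ ‖T eᵢ‖²)^{1/2}`, with values in `[0, ∞]`: the sum over an
orthonormal basis is written basis-free, as the supremum of the sums over finite orthonormal
families. -/
def hsNorm (T : E →L[ℝ] F) : ℝ≥0∞ :=
  (⨆ (s : Finset E) (_ : Orthonormal ℝ ((↑) : s → E)), ∑ e ∈ s, ‖T e‖ₑ ^ 2) ^ (1 / 2 : ℝ)

/-- `T` is a Hilbert–Schmidt operator. -/
def IsHilbertSchmidt (T : E →L[ℝ] F) : Prop := hsNorm T < ∞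

end HilbertSchmidt

variable {H : Type*} [NormedAddCommGroup H] [InnerProductSpace ℝ H] [CompleteSpace H]

/-- A strictly positive bounded operator: symmetric, with `⟪C x, x⟫ > 0` for `x ≠ 0`. -/
structure StrictlyPositive (C : H →L[ℝ] H) : Prop where
  isPositive : C.IsPositive
  inner_pos : ∀ x : H, x ≠ 0 → 0 < ⟪C x, x⟫

theorem StrictlyPositive.posSqrt_injective {C : H →L[ℝ] H} (hC : StrictlyPositive C) :
    Function.Injective (posSqrt C hC.isPositive) := by
  refine (injective_iff_map_eq_zero _).2 fun x hx => ?_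
  by_contra h
  have h1 := hC.inner_pos x h
  rw [← posSqrt_comp_self hC.isPositive] at h1
  simp [hx] at h1

/-- `C^{1/2}` as a linear bijection from `H` onto its image; its inverse is `C^{-1/2}`. -/
def sqrtRangeEquiv {C : H →L[ℝ] H} (hC : StrictlyPositive C) :
    H ≃ₗ[ℝ] LinearMap.range (posSqrt C hC.isPositive : H →ₗ[ℝ] H) :=
  LinearEquiv.ofInjective (posSqrt C hC.isPositive : H →ₗ[ℝ] H) hC.posSqrt_injective

/-- The scalar product `⟪C^{-1/2} u, C^{-1/2} v⟫` on the image of `C^{1/2}`. -/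
@[reducible]
def cameronMartinCore {C : H →L[ℝ] H} (hC : StrictlyPositive C) :
    InnerProductSpace.Core ℝ (LinearMap.range (posSqrt C hC.isPositive : H →ₗ[ℝ] H)) where
  inner u v := ⟪(sqrtRangeEquiv hC).symm u, (sqrtRangeEquiv hC).symm v⟫
  conj_inner_symm u v := by simp [real_inner_comm]
  re_inner_nonneg u := by simp
  add_left u v w := by simp [inner_add_left]
  smul_left u v r := by simp [real_inner_smul_left]
  definite u hu := by simpa using hu

/-- The Cameron–Martin space `H¹`: the image of `C^{1/2}`, with the scalar product
`⟪C^{-1/2} u, C^{-1/2} v⟫` in place of the one it inherits from `H`. -/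
def CameronMartin (C : H →L[ℝ] H) (hC : StrictlyPositive C) : Type _ :=
  LinearMap.range (posSqrt C hC.isPositive : H →ₗ[ℝ] H)

namespace CameronMartin

variable {C : H →L[ℝ] H} {hC : StrictlyPositive C}

instance : NormedAddCommGroup (CameronMartin C hC) :=
  (cameronMartinCore hC).toNormedAddCommGroup

instance : InnerProductSpace ℝ (CameronMartin C hC) :=
  InnerProductSpace.ofCore (cameronMartinCore hC).toCore

/-- `C^{1/2}` as a linear bijection from `H` onto `H¹`; its inverse is `C^{-1/2}`. -/
def sqrtEquiv : H ≃ₗ[ℝ] CameronMartin C hC := sqrtRangeEquiv hC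

theorem inner_def (u v : CameronMartin C hC) :
    ⟪u, v⟫ = ⟪sqrtEquiv.symm u, sqrtEquiv.symm v⟫ := rfl

theorem norm_def (u : CameronMartin C hC) : ‖u‖ = ‖sqrtEquiv.symm u‖ := by
  rw [norm_eq_sqrt_real_inner, norm_eq_sqrt_real_inner, inner_def]

/-- The inclusion of `H¹` in `H`, as a linear map. -/
def inclₗ : CameronMartin C hC →ₗ[ℝ] H :=
  Submodule.subtype (LinearMap.range (posSqrt C hC.isPositive : H →ₗ[ℝ] H))

theorem inclₗ_sqrtEquiv (x : H) :
    inclₗ (sqrtEquiv x : CameronMartin C hC) = posSqrt C hC.isPositive x := rfl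

/-- The continuous inclusion of `H¹` in `H`. -/
def incl : CameronMartin C hC →L[ℝ] H :=
  inclₗ.mkContinuous ‖posSqrt C hC.isPositive‖ fun u => by
    obtain ⟨x, rfl⟩ := (sqrtEquiv (C := C) (hC := hC)).surjective u
    rw [inclₗ_sqrtEquiv, norm_def, LinearEquiv.symm_apply_apply]
    exact ContinuousLinearMap.le_opNorm _ _

end CameronMartin

/-- The space `H⁻¹`, the dual of `H¹` with the dual norm. -/
abbrev CameronMartinDual (C : H →L[ℝ] H) (hC : StrictlyPositive C) : Type _ :=
  StrongDual ℝ (CameronMartin C hC)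

/-- The norm of `H¹` on all of `H`, with the value `∞` outside `H¹`. -/
def cameronMartinENorm (C : H →L[ℝ] H) (hC : StrictlyPositive C) (x : H) : ℝ≥0∞ :=
  ⨅ (u : CameronMartin C hC) (_ : CameronMartin.incl u = x), ‖u‖ₑ

section Precision

variable {C₀ : H →L[ℝ] H} {hC₀ : StrictlyPositive C₀}

/-- The embedding `x ↦ ⟪x, ·⟫` of `H` in `H⁻¹`. -/
def toDual (x : H) : CameronMartinDual C₀ hC₀ := (innerSL ℝ x) ∘L CameronMartin.incl

/-- `C₀⁻¹` as an operator from `H¹` to `H⁻¹`, namely `u ↦ ⟪C₀^{-1/2} u, C₀^{-1/2} ·⟫`. -/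
def invCov : CameronMartin C₀ hC₀ →L[ℝ] CameronMartinDual C₀ hC₀ :=
  (innerₗ (CameronMartin C₀ hC₀)).mkContinuous₂ 1 fun u v => by
    simpa using abs_real_inner_le_norm u v

theorem invCov_apply (u v : CameronMartin C₀ hC₀) : invCov u v = ⟪u, v⟫ := rfl

/-- `C₀⁻¹ + Γ` as an operator from `H¹` to `H⁻¹`. -/
def precision (Γ : CameronMartin C₀ hC₀ →L[ℝ] CameronMartinDual C₀ hC₀) :
    CameronMartin C₀ hC₀ →L[ℝ] CameronMartinDual C₀ hC₀ :=
  invCov + Γ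

/-- `C₀⁻¹ + Γ` is strictly positive: its form on `H¹` is symmetric and strictly positive. -/
def PrecisionPos (Γ : CameronMartin C₀ hC₀ →L[ℝ] CameronMartinDual C₀ hC₀) : Prop :=
  (∀ u v, precision Γ u v = precision Γ v u) ∧ ∀ u, u ≠ 0 → 0 < precision Γ u u

/-- `C = (C₀⁻¹ + Γ)⁻¹` as operators on `H`: for every `x`, the element `C x` lies in `H¹` and
`(C₀⁻¹ + Γ)(C x) = x`. -/
def IsPrecisionInverse (Γ : CameronMartin C₀ hC₀ →L[ℝ] CameronMartinDual C₀ hC₀)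
    (C : H →L[ℝ] H) : Prop :=
  ∀ x : H, ∃ u : CameronMartin C₀ hC₀, CameronMartin.incl u = C x ∧ precision Γ u = toDual x

end Precision

variable [MeasurableSpace H] [BorelSpace H]

/-- `ν` is the Gaussian measure `N(m, C)` with mean `m` and covariance operator `C`. -/
structure IsGaussianLaw (ν : Measure H) (m : H) (C : H →L[ℝ] H) : Prop where
  isGaussian : IsGaussian ν
  mean : ∫ x, x ∂ν = m
  covariance : ∀ y₁ y₂ : H, covarianceBilin ν y₁ y₂ = ⟪y₁, C y₂⟫

/-- `ν` is the measure `N_{P,0}(m, Γ)`: the Gaussian measure with mean `m` and covariance operator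
`(C₀⁻¹ + Γ)⁻¹` if `C₀⁻¹ + Γ` is strictly positive, and the Dirac measure at `m` otherwise. -/
structure IsPrecisionGaussian {C₀ : H →L[ℝ] H} {hC₀ : StrictlyPositive C₀} (ν : Measure H)
    (m : H) (Γ : CameronMartin C₀ hC₀ →L[ℝ] CameronMartinDual C₀ hC₀) : Prop where
  of_pos : PrecisionPos Γ → ∃ C : H →L[ℝ] H, IsPrecisionInverse Γ C ∧ IsGaussianLaw ν m C
  of_not_pos : ¬ PrecisionPos Γ → ν = Measure.dirac m

/-- The function `exp (-Φ)` on `H`, for `Φ : X → ℝ` on a subspace `ι : X → H`; it is extended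
by zero outside `X`. -/
def expNeg {X : Type*} (ι : X → H) (Φ : X → ℝ) : H → ℝ :=
  Function.extend ι (fun x => Real.exp (-Φ x)) 0

/-- The target measure `μ`, with `dμ/dμ₀ = Z⁻¹ exp (-Φ)`, `Z = ∫ exp (-Φ) dμ₀`. -/
def targetMeasure {X : Type*} (μ₀ : Measure H) (ι : X → H) (Φ : X → ℝ) : Measure H :=
  μ₀.withDensity fun x => ENNReal.ofReal ((∫ z, expNeg ι Φ z ∂μ₀)⁻¹ * expNeg ι Φ x)

end GaussianKL

end

/-! Convergence of the divergences upgrades weak convergence to strong convergence of densities, and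
Gaussian measures with close densities have close means and precisions.

For bounded `g`, the defect `KL(ν‖μ) - ∫ g dν + ∫ (e^g - 1) dμ` of the Gibbs variational formula is
nonnegative and dominates the squared Hellinger distance between `ν` and `e^g μ`. A bounded
continuous `g` makes the defect of `ν⋆` small. Both the divergence and `∫ g dν_n` pass to the limit,
so the same `g` has small defect for all late `ν_n`. These measures are then all Hellinger-close to
`e^g μ`, hence to each other (`eventually_hellingerSq_le`).

Expectations under Hellinger-close measures differ by little relative to standard deviations. Linear
functionals control the means, squares show that variances agree up to a factor two, and the
quadratic form whose coefficients are the covariance difference controls that difference in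
Hilbert–Schmidt norm. By Isserlis' formula the last estimate does not depend on the dimension
(`sum_sq_covariance_sub_le`).

With `J : H¹ → H` the inclusion, the covariance of `ν_n` is `J B_n J†`, where `P_n = B_n⁻¹` is the
identity plus the Riesz representative of `Γ_n`. The factor two bounds `B_n` and `P_n` uniformly,
and `P_n - P_k = P_n (B_k - B_n) P_k` makes `Γ_n` Cauchy in Hilbert–Schmidt norm. The bound on `B_n`
keeps the limit coercive, and characteristic functions identify `ν⋆`. The Dirac case is excluded for
late `n`: finite divergence forces `ν_n ≪ μ₀`, and `μ₀` has no atoms unless `H = 0`. -/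

noncomputable section

namespace GaussianKL

open InformationTheory
open scoped BoundedContinuousFunction

/-! ### The variational defect of relative entropy and the Hellinger distance. -/

section Hellinger

/-- The right side is the Fenchel–Young gap between `f log f - f` and its conjugate `e^g`. The bound
is `log x ≤ x - 1` at `x = √(e^g / f)`, multiplied by `2 f`. -/
lemma sq_sqrt_sub_sqrt_exp_le {f : ℝ} (hf : 0 ≤ f) (g : ℝ) :
    (√f - √(Real.exp g)) ^ 2 ≤ klFun f - f * g + (Real.exp g - 1) := by
  have hg := Real.exp_pos g
  rcases hf.eq_or_lt with rfl | hf
  · simp [klFun_zero, Real.sq_sqrt hg.le]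
  have h1 := Real.log_le_sub_one_of_pos (x := √(Real.exp g) / √f) (by positivity)
  rw [Real.log_div (by positivity) (by positivity), Real.log_sqrt hg.le, Real.log_sqrt hf.le,
    Real.log_exp, le_sub_iff_add_le, le_div_iff₀ (by positivity)] at h1
  have h2 : (√f - √(Real.exp g)) ^ 2 = f - 2 * (√(Real.exp g) * √f) + Real.exp g := by
    rw [sub_sq, Real.sq_sqrt hf.le, Real.sq_sqrt hg.le]; ring
  have h3 := mul_le_mul_of_nonneg_right h1 (Real.sqrt_nonneg f)
  rw [mul_assoc, Real.mul_self_sqrt hf.le] at h3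
  rw [h2, klFun_apply]
  linarith

lemma klFun_sub_mul_add_exp_nonneg {f : ℝ} (hf : 0 ≤ f) (g : ℝ) :
    0 ≤ klFun f - f * g + (Real.exp g - 1) :=
  (sq_nonneg _).trans (sq_sqrt_sub_sqrt_exp_le hf g)

lemma exp_sub_exp_le {a b k : ℝ} (ha : a ≤ k) : Real.exp a - Real.exp b ≤ Real.exp k * |a - b| := by
  have h1 : Real.exp a * (1 + (b - a)) ≤ Real.exp b := by
    calc Real.exp a * (1 + (b - a)) ≤ Real.exp a * Real.exp (b - a) := by
          gcongr; linarith [Real.add_one_le_exp (b - a)]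
      _ = Real.exp b := by rw [← Real.exp_add]; congr 1; ring
  calc Real.exp a - Real.exp b ≤ Real.exp a * (a - b) := by linarith
    _ ≤ Real.exp a * |a - b| := by gcongr; exact le_abs_self _
    _ ≤ Real.exp k * |a - b| := by gcongr

variable {α : Type*} [MeasurableSpace α]

/-- The squared Hellinger distance of two measures with densities with respect to `μ`. -/
def hellingerSq (μ ν ν' : Measure α) : ℝ :=
  ∫ x, (√(ν.rnDeriv μ x).toReal - √(ν'.rnDeriv μ x).toReal) ^ 2 ∂μ

/-- The logarithm of `t` truncated to `[-k, k]`. -/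
def truncLog (k : ℕ) (t : ℝ) : ℝ := Real.log (max (Real.exp (-k)) (min (Real.exp k) t))

lemma measurable_truncLog (k : ℕ) : Measurable (truncLog k) := by
  unfold truncLog; fun_prop

lemma abs_truncLog_le (k : ℕ) (t : ℝ) : |truncLog k t| ≤ k := by
  have h0 : 0 < max (Real.exp (-k)) (min (Real.exp k) t) := lt_max_of_lt_left (Real.exp_pos _)
  rw [abs_le, truncLog]
  refine ⟨(Real.le_log_iff_exp_le h0).2 (le_max_left _ _), (Real.log_le_iff_le_exp h0).2 ?_⟩
  exact max_le (Real.exp_le_exp.2 (by linarith [Nat.cast_nonneg (α := ℝ) k])) (min_le_left _ _)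

lemma exp_truncLog (k : ℕ) (t : ℝ) :
    Real.exp (truncLog k t) = max (Real.exp (-k)) (min (Real.exp k) t) :=
  Real.exp_log (lt_max_of_lt_left (Real.exp_pos _))

/-- Supplies the dominating function for the limit `k → ∞` in `exists_truncLog_le`. The gap vanishes
where the truncation is inactive; on the two outer ranges `x + 1 ≤ e^x` bounds it. -/
lemma klFun_sub_mul_truncLog_le (k : ℕ) {t : ℝ} (ht : 0 ≤ t) :
    klFun t - t * truncLog k t + (Real.exp (truncLog k t) - 1) ≤ klFun t + 1 := by
  have hk : (0 : ℝ) ≤ k := Nat.cast_nonneg k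
  have hkk : Real.exp (-k) ≤ Real.exp k := Real.exp_le_exp.2 (by linarith)
  rcases le_total t (Real.exp (-k)) with h | h
  · have e1 : Real.exp (truncLog k t) = Real.exp (-k) := by
      rw [exp_truncLog, min_eq_right (h.trans hkk), max_eq_left h]
    have e2 : truncLog k t = -k := Real.exp_injective e1
    rw [e2]
    have e3 : Real.exp (-(k : ℝ)) * (k + 1) ≤ 1 := by
      calc Real.exp (-(k : ℝ)) * (k + 1) ≤ Real.exp (-(k : ℝ)) * Real.exp k := by
            gcongr; exact Real.add_one_le_exp _
        _ = 1 := by rw [← Real.exp_add]; simp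
    nlinarith
  rcases le_total t (Real.exp k) with h' | h'
  · have e1 : Real.exp (truncLog k t) = t := by
      rw [exp_truncLog, min_eq_right h', max_eq_right h]
    have e0 : 0 < t := (Real.exp_pos _).trans_le h
    have e2 : truncLog k t = Real.log t := by rw [← Real.log_exp (truncLog k t), e1]
    rw [e1, e2]
    have := klFun_nonneg ht
    have e3 : t * Real.log t = klFun t - 1 + t := by rw [klFun_apply]; ring
    rw [e3]
    linarith
  · have e1 : Real.exp (truncLog k t) = Real.exp k := by
      rw [exp_truncLog, min_eq_left h', max_eq_right hkk]
    have e2 : truncLog k t = k := Real.exp_injective e1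
    rw [e2]
    have e3 : Real.exp (k : ℝ) * (1 - k) ≤ 1 := by
      calc Real.exp (k : ℝ) * (1 - k) ≤ Real.exp (k : ℝ) * Real.exp (-k) := by
            gcongr; linarith [Real.add_one_le_exp (-(k : ℝ))]
        _ = 1 := by rw [← Real.exp_add]; simp
    nlinarith

lemma tendsto_klFun_sub_mul_truncLog {t : ℝ} (ht : 0 ≤ t) :
    Tendsto (fun k : ℕ => klFun t - t * truncLog k t + (Real.exp (truncLog k t) - 1)) atTop
      (𝓝 0) := by
  have hlim : Tendsto (fun k : ℕ => Real.exp (-(k : ℝ))) atTop (𝓝 0) :=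
    Real.tendsto_exp_neg_atTop_nhds_zero.comp tendsto_natCast_atTop_atTop
  rcases ht.eq_or_lt with rfl | ht
  -- At `t = 0` the truncated logarithm is `-k`, so the gap is `e^{-k}`; for `t > 0` the gap is
  -- eventually zero.
  · refine hlim.congr fun k => ?_
    rw [exp_truncLog, min_eq_right (Real.exp_pos _).le, max_eq_left (Real.exp_pos _).le, klFun_zero]
    ring
  · have h1 : ∀ᶠ k : ℕ in atTop, Real.exp (-(k : ℝ)) < t := hlim.eventually_lt_const ht
    have h2 : ∀ᶠ k : ℕ in atTop, t ≤ Real.exp k :=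
      (Real.tendsto_exp_atTop.comp tendsto_natCast_atTop_atTop).eventually_ge_atTop t
    refine tendsto_const_nhds.congr' ?_
    filter_upwards [h1, h2] with k h h'
    have e1 : Real.exp (truncLog k t) = t := by
      rw [exp_truncLog, min_eq_right h', max_eq_right h.le]
    have e2 : truncLog k t = Real.log t := by rw [← Real.log_exp (truncLog k t), e1]
    rw [e1, e2, klFun_apply]
    ring

lemma integrable_sq_sqrt_sub_sqrt {μ : Measure α} {f g : α → ℝ} (hf : Integrable f μ) (hg : Integrable g μ)
    (hf0 : ∀ x, 0 ≤ f x) (hg0 : ∀ x, 0 ≤ g x) :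
    Integrable (fun x => (√(f x) - √(g x)) ^ 2) μ := by
  refine ((hf.add hg).const_mul 2).mono' ?_ (ae_of_all _ fun x => ?_)
  · have h1 := hf.1.aemeasurable
    have h2 := hg.1.aemeasurable
    exact AEMeasurable.aestronglyMeasurable (by fun_prop)
  · rw [Real.norm_of_nonneg (sq_nonneg _)]
    have e1 := Real.sq_sqrt (hf0 x)
    have e2 := Real.sq_sqrt (hg0 x)
    simp only [Pi.add_apply]
    nlinarith [sq_nonneg (√(f x) + √(g x))]

lemma integrable_toReal_rnDeriv_mul {μ ν : Measure α} [IsFiniteMeasure ν] {g : α → ℝ}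
    (hg : Measurable g) {k : ℝ} (hk : ∀ x, |g x| ≤ k) :
    Integrable (fun x => (ν.rnDeriv μ x).toReal * g x) μ :=
  Measure.integrable_toReal_rnDeriv.mul_bdd hg.aestronglyMeasurable (ae_of_all _ hk)

variable {μ ν : Measure α} [IsFiniteMeasure μ] [IsFiniteMeasure ν]

lemma integrable_klFun_of_klDiv_ne_top (h : klDiv ν μ ≠ ∞) :
    Integrable (fun x => klFun (ν.rnDeriv μ x).toReal) μ :=
  have h' := klDiv_ne_top_iff.1 h
  (integrable_klFun_rnDeriv_iff h'.1).2 h'.2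

lemma integrable_exp_sub_one {g : α → ℝ} (hg : Measurable g) {k : ℝ} (hk : ∀ x, |g x| ≤ k) :
    Integrable (fun x => Real.exp (g x) - 1) μ := by
  refine Integrable.sub ?_ (integrable_const _)
  refine Integrable.of_bound (by fun_prop) (Real.exp k) (ae_of_all _ fun x => ?_)
  rw [Real.norm_of_nonneg (Real.exp_pos _).le]
  exact Real.exp_le_exp.2 ((le_abs_self _).trans (hk x))

lemma integral_klFun_sub_mul_add_exp (h : klDiv ν μ ≠ ∞) {g : α → ℝ} (hg : Measurable g) {k : ℝ}
    (hk : ∀ x, |g x| ≤ k) :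
    ∫ x, (klFun (ν.rnDeriv μ x).toReal - (ν.rnDeriv μ x).toReal * g x + (Real.exp (g x) - 1)) ∂μ
      = (klDiv ν μ).toReal - ∫ x, g x ∂ν + ∫ x, (Real.exp (g x) - 1) ∂μ := by
  have h' := klDiv_ne_top_iff.1 h
  have i1 := integrable_klFun_of_klDiv_ne_top h
  have i2 : Integrable (fun x => (ν.rnDeriv μ x).toReal * g x) μ :=
    integrable_toReal_rnDeriv_mul hg hk
  rw [integral_add (i1.sub' i2) (integrable_exp_sub_one hg hk), integral_sub i1 i2,
    toReal_klDiv_eq_integral_klFun h'.1, ← integral_rnDeriv_smul h'.1]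
  rfl

lemma measurable_toReal_rnDeriv (μ ν : Measure α) :
    Measurable fun x => (ν.rnDeriv μ x).toReal :=
  (Measure.measurable_rnDeriv ν μ).ennreal_toReal

lemma integral_sq_sqrt_sub_sqrt_exp_le (h : klDiv ν μ ≠ ∞) {g : α → ℝ} (hg : Measurable g) {k : ℝ}
    (hk : ∀ x, |g x| ≤ k) :
    ∫ x, (√(ν.rnDeriv μ x).toReal - √(Real.exp (g x))) ^ 2 ∂μ
      ≤ (klDiv ν μ).toReal - ∫ x, g x ∂ν + ∫ x, (Real.exp (g x) - 1) ∂μ := by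
  rw [← integral_klFun_sub_mul_add_exp h hg hk]
  refine integral_mono_of_nonneg (ae_of_all _ fun x => sq_nonneg _)
    (((integrable_klFun_of_klDiv_ne_top h).sub (integrable_toReal_rnDeriv_mul hg hk)).add
      (integrable_exp_sub_one hg hk))
    (ae_of_all _ fun x => sq_sqrt_sub_sqrt_exp_le ENNReal.toReal_nonneg _)

/-- The optimal test function is the logarithm of the density; its truncations are bounded and
nearly optimal, by dominated convergence. -/
lemma exists_truncLog_le (h : klDiv ν μ ≠ ∞) {ε : ℝ} (hε : 0 < ε) :
    ∃ k : ℕ, (klDiv ν μ).toReal - ∫ x, truncLog k (ν.rnDeriv μ x).toReal ∂ν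
      + ∫ x, (Real.exp (truncLog k (ν.rnDeriv μ x).toReal) - 1) ∂μ < ε := by
  have hm := measurable_toReal_rnDeriv μ ν
  have key : Tendsto (fun k : ℕ => ∫ x, (klFun (ν.rnDeriv μ x).toReal
      - (ν.rnDeriv μ x).toReal * truncLog k (ν.rnDeriv μ x).toReal
      + (Real.exp (truncLog k (ν.rnDeriv μ x).toReal) - 1)) ∂μ) atTop (𝓝 (∫ _, (0 : ℝ) ∂μ)) := by
    refine tendsto_integral_of_dominated_convergence
      (fun x => klFun (ν.rnDeriv μ x).toReal + 1) (fun k => ?_)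
      ((integrable_klFun_of_klDiv_ne_top h).add (integrable_const _)) (fun k => ?_) ?_
    · have h1 := (measurable_truncLog k).comp hm
      have h2 := measurable_klFun.comp hm
      have h3 := h1.exp
      exact ((h2.sub (hm.mul h1)).add (h3.sub_const 1)).aestronglyMeasurable
    · refine ae_of_all _ fun x => ?_
      rw [Real.norm_of_nonneg (klFun_sub_mul_add_exp_nonneg ENNReal.toReal_nonneg _)]
      exact klFun_sub_mul_truncLog_le k ENNReal.toReal_nonneg
    · exact ae_of_all _ fun x => tendsto_klFun_sub_mul_truncLog ENNReal.toReal_nonneg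
  rw [integral_zero] at key
  obtain ⟨k, hk⟩ := (key.eventually_lt_const hε).exists
  refine ⟨k, ?_⟩
  rwa [integral_klFun_sub_mul_add_exp h (g := fun x => truncLog k (ν.rnDeriv μ x).toReal)
    ((measurable_truncLog k).comp hm) (fun x => abs_truncLog_le k _)] at hk

end Hellinger

/-! ### From weak convergence and convergence of entropies to Hellinger Cauchy sequences. -/

section Weak

variable {α : Type*} [MetricSpace α] [MeasurableSpace α] [BorelSpace α]

/-- Continuity of the test function is what lets weak convergence act on the defect. The truncated
log-density is approximated in `L¹(μ + ν)` and cut off again at `k`, since `exp` is Lipschitz with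
constant `e^k` below `k`. -/
lemma exists_boundedContinuous_kl_le {μ ν : Measure α} [IsFiniteMeasure μ] [IsFiniteMeasure ν]
    (h : klDiv ν μ ≠ ∞) {ε : ℝ} (hε : 0 < ε) :
    ∃ g : α →ᵇ ℝ, (klDiv ν μ).toReal - ∫ x, g x ∂ν + ∫ x, (Real.exp (g x) - 1) ∂μ < ε := by
  obtain ⟨k, hk⟩ := exists_truncLog_le h (half_pos hε)
  set g₀ : α → ℝ := fun x => truncLog k (ν.rnDeriv μ x).toReal with hg₀
  have hm₀ : Measurable g₀ := (measurable_truncLog k).comp (measurable_toReal_rnDeriv μ ν)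
  have hb₀ : ∀ x, |g₀ x| ≤ k := fun x => abs_truncLog_le k _
  have hi₀ : Integrable g₀ (μ + ν) :=
    Integrable.of_bound hm₀.aestronglyMeasurable k (ae_of_all _ hb₀)
  -- An `L¹` error `δ` costs at most `δ` in the linear term and `e^k δ` in the exponential one.
  set δ : ℝ := ε / 2 / (1 + Real.exp k) with hδ
  have hδ0 : 0 < δ := by positivity
  obtain ⟨g₁, hg₁, -⟩ := hi₀.exists_boundedContinuous_integral_sub_le hδ0
  have hk0 : (0 : ℝ) ≤ k := Nat.cast_nonneg k
  have hb : ∀ x, ‖max (-(k : ℝ)) (min (k : ℝ) (g₁ x))‖ ≤ k := fun x => by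
    rw [Real.norm_eq_abs, abs_le]
    exact ⟨le_max_left _ _, max_le (by linarith) (min_le_left _ _)⟩
  let g : α →ᵇ ℝ := BoundedContinuousFunction.ofNormedAddCommGroup
    (fun x => max (-(k : ℝ)) (min (k : ℝ) (g₁ x))) (by fun_prop) k hb
  have hgx : ∀ x, g x = max (-(k : ℝ)) (min (k : ℝ) (g₁ x)) := fun x => rfl
  have hgb : ∀ x, |g x| ≤ k := hb
  have hgm : Measurable g := g.continuous.measurable
  have hclose : ∀ x, |g₀ x - g x| ≤ |g₀ x - g₁ x| := fun x => by
    have e1 := abs_le.1 (hb₀ x)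
    have e2 : g₀ x = max (-(k : ℝ)) (min (k : ℝ) (g₀ x)) := by
      rw [min_eq_right e1.2, max_eq_right e1.1]
    rw [hgx]
    nth_rewrite 1 [e2]
    calc _ ≤ max |(-(k : ℝ)) - (-(k : ℝ))| |min (k : ℝ) (g₀ x) - min (k : ℝ) (g₁ x)| :=
          abs_max_sub_max_le_max _ _ _ _
      _ ≤ max 0 (max |(k : ℝ) - k| |g₀ x - g₁ x|) := by
          gcongr
          · simp
          · exact abs_min_sub_min_le_max _ _ _ _
      _ = |g₀ x - g₁ x| := by simp
  have hid : ∀ (ρ : Measure α) [IsFiniteMeasure ρ], Integrable (fun x => |g₀ x - g x|) ρ := by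
    intro ρ _
    refine Integrable.abs (Integrable.sub ?_ ?_)
    · exact Integrable.of_bound hm₀.aestronglyMeasurable k (ae_of_all _ hb₀)
    · exact Integrable.of_bound hgm.aestronglyMeasurable k (ae_of_all _ hgb)
  have hint : ∫ x, |g₀ x - g x| ∂μ + ∫ x, |g₀ x - g x| ∂ν ≤ δ := by
    rw [← integral_add_measure (hid μ) (hid ν)]
    refine le_trans (integral_mono (hid _) ?_ hclose) hg₁
    exact (hi₀.sub (g₁.integrable (μ + ν))).abs
  have hn1 : 0 ≤ ∫ x, |g₀ x - g x| ∂μ := integral_nonneg fun x => abs_nonneg _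
  have hn2 : 0 ≤ ∫ x, |g₀ x - g x| ∂ν := integral_nonneg fun x => abs_nonneg _
  have hν : ∫ x, g₀ x ∂ν - ∫ x, g x ∂ν ≤ ∫ x, |g₀ x - g x| ∂ν := by
    rw [← integral_sub (Integrable.of_bound hm₀.aestronglyMeasurable k (ae_of_all _ hb₀))
      (g.integrable ν)]
    refine integral_mono ?_ (hid ν) fun x => le_abs_self _
    exact (Integrable.of_bound hm₀.aestronglyMeasurable k (ae_of_all _ hb₀)).sub (g.integrable ν)
  have hμ : ∫ x, (Real.exp (g x) - 1) ∂μ - ∫ x, (Real.exp (g₀ x) - 1) ∂μ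
      ≤ Real.exp k * ∫ x, |g₀ x - g x| ∂μ := by
    rw [← integral_sub (integrable_exp_sub_one hgm hgb) (integrable_exp_sub_one hm₀ hb₀),
      ← integral_const_mul]
    refine integral_mono
      ((integrable_exp_sub_one hgm hgb).sub (integrable_exp_sub_one hm₀ hb₀))
      ((hid μ).const_mul _) fun x => ?_
    have := exp_sub_exp_le (a := g x) (b := g₀ x) (le_of_abs_le (hgb x))
    rw [abs_sub_comm] at this
    simp only [sub_sub_sub_cancel_right]
    exact this
  refine ⟨g, ?_⟩
  have e1 : (1 + Real.exp k) * δ = ε / 2 := by rw [hδ]; field_simp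
  have e2 := Real.exp_pos (k : ℝ)
  nlinarith

/-- If `ν n → ν₀` weakly and `KL(ν n ‖ μ) → KL(ν₀ ‖ μ) < ∞`, then the densities of `ν n` form a
Cauchy sequence for the Hellinger distance. -/
theorem eventually_hellingerSq_le {μ : Measure α} [IsFiniteMeasure μ] {ν : ℕ → ProbabilityMeasure α}
    {ν₀ : ProbabilityMeasure α} (hweak : Tendsto ν atTop (𝓝 ν₀))
    (hfin : klDiv (ν₀ : Measure α) μ ≠ ∞)
    (hKL : Tendsto (fun n => klDiv (ν n : Measure α) μ) atTop (𝓝 (klDiv (ν₀ : Measure α) μ)))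
    {ε : ℝ} (hε : 0 < ε) :
    ∃ N, ∀ n ≥ N, ∀ k ≥ N, hellingerSq μ (ν n) (ν k) ≤ ε := by
  obtain ⟨g, hg⟩ := exists_boundedContinuous_kl_le hfin (ε := ε / 4) (by positivity)
  have h1 : Tendsto (fun n => ∫ x, g x ∂(ν n : Measure α)) atTop
      (𝓝 (∫ x, g x ∂(ν₀ : Measure α))) :=
    (ProbabilityMeasure.tendsto_iff_forall_integral_tendsto.1 hweak) g
  have h2 := (ENNReal.tendsto_toReal hfin).comp hKL
  have h3 : ∀ᶠ n in atTop, klDiv (ν n : Measure α) μ ≠ ∞ :=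
    hKL.eventually_ne hfin
  -- The defect of `ν n` against the fixed `g` converges to that of `ν₀`, so one `g` serves all late
  -- indices.
  have h4 := ((h2.sub h1).add_const (∫ x, (Real.exp (g x) - 1) ∂μ)).eventually_lt_const hg
  obtain ⟨N, hN⟩ := (h3.and h4).exists_forall_of_atTop
  have hgb : ∀ x, |g x| ≤ ‖g‖ := fun x => g.norm_coe_le_norm x
  have hgm : Measurable g := g.continuous.measurable
  have hgi : Integrable (fun x => Real.exp (g x)) μ := by
    refine ((integrable_exp_sub_one (μ := μ) hgm hgb).add (integrable_const 1)).congr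
      (ae_of_all _ fun x => ?_)
    simp
  have hdi : ∀ n, Integrable (fun x => ((ν n : Measure α).rnDeriv μ x).toReal) μ :=
    fun n => Measure.integrable_toReal_rnDeriv
  have hb : ∀ n ≥ N,
      ∫ x, (√((ν n : Measure α).rnDeriv μ x).toReal - √(Real.exp (g x))) ^ 2 ∂μ ≤ ε / 4 :=
    fun n hn => (integral_sq_sqrt_sub_sqrt_exp_le (hN n hn).1 hgm hgb).trans (hN n hn).2.le
  have hi : ∀ n, Integrable
      (fun x => (√((ν n : Measure α).rnDeriv μ x).toReal - √(Real.exp (g x))) ^ 2) μ :=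
    fun n => integrable_sq_sqrt_sub_sqrt (hdi n) hgi (fun _ => ENNReal.toReal_nonneg)
      fun _ => (Real.exp_pos _).le
  refine ⟨N, fun n hn k hk => ?_⟩
  have : hellingerSq μ (ν n) (ν k)
      ≤ 2 * ∫ x, (√((ν n : Measure α).rnDeriv μ x).toReal - √(Real.exp (g x))) ^ 2 ∂μ
        + 2 * ∫ x, (√((ν k : Measure α).rnDeriv μ x).toReal - √(Real.exp (g x))) ^ 2 ∂μ := by
    rw [hellingerSq, ← integral_const_mul, ← integral_const_mul,
      ← integral_add ((hi n).const_mul 2) ((hi k).const_mul 2)]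
    refine integral_mono_of_nonneg (ae_of_all _ fun x => sq_nonneg _)
      (((hi n).const_mul 2).add ((hi k).const_mul 2)) (ae_of_all _ fun x => ?_)
    simp only
    nlinarith [sq_nonneg (√((ν n : Measure α).rnDeriv μ x).toReal - √(Real.exp (g x))
      + (√((ν k : Measure α).rnDeriv μ x).toReal - √(Real.exp (g x))))]
  linarith [hb n hn, hb k hk]

end Weak

/-! ### Expectations under Hellinger-close measures. -/

section Expectation

variable {α : Type*} [MeasurableSpace α] {μ ν ν' : Measure α}

lemma hellingerSq_nonneg : 0 ≤ hellingerSq μ ν ν' := integral_nonneg fun _ => sq_nonneg _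

variable [IsFiniteMeasure μ] [IsProbabilityMeasure ν] [IsProbabilityMeasure ν']

/-- Cauchy–Schwarz for `f - f' = (√f - √f')(√f + √f')`, obtained from the discriminant of a
quadratic in `t` that is pointwise a sum of two squares. -/
lemma sq_integral_sub_integral_le (hν : ν ≪ μ) (hν' : ν' ≪ μ) {Q : α → ℝ} (hQ : MemLp Q 2 ν)
    (hQ' : MemLp Q 2 ν') :
    (∫ x, Q x ∂ν - ∫ x, Q x ∂ν') ^ 2
      ≤ 2 * hellingerSq μ ν ν' * (∫ x, Q x ^ 2 ∂ν + ∫ x, Q x ^ 2 ∂ν') := by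
  set f : α → ℝ := fun x => (ν.rnDeriv μ x).toReal with hf
  set f' : α → ℝ := fun x => (ν'.rnDeriv μ x).toReal with hf'
  have hf0 : ∀ x, 0 ≤ f x := fun x => ENNReal.toReal_nonneg
  have hf0' : ∀ x, 0 ≤ f' x := fun x => ENNReal.toReal_nonneg
  have i1 : Integrable (fun x => f x * Q x) μ :=
    (integrable_rnDeriv_smul_iff hν).2 (hQ.integrable one_le_two)
  have i1' : Integrable (fun x => f' x * Q x) μ :=
    (integrable_rnDeriv_smul_iff hν').2 (hQ'.integrable one_le_two)
  have i2 : Integrable (fun x => f x * Q x ^ 2) μ :=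
    (integrable_rnDeriv_smul_iff hν).2 hQ.integrable_sq
  have i2' : Integrable (fun x => f' x * Q x ^ 2) μ :=
    (integrable_rnDeriv_smul_iff hν').2 hQ'.integrable_sq
  have e1 : ∫ x, Q x ∂ν = ∫ x, f x * Q x ∂μ := (integral_rnDeriv_smul hν).symm
  have e1' : ∫ x, Q x ∂ν' = ∫ x, f' x * Q x ∂μ := (integral_rnDeriv_smul hν').symm
  have e2 : ∫ x, Q x ^ 2 ∂ν = ∫ x, f x * Q x ^ 2 ∂μ := (integral_rnDeriv_smul hν).symm
  have e2' : ∫ x, Q x ^ 2 ∂ν' = ∫ x, f' x * Q x ^ 2 ∂μ := (integral_rnDeriv_smul hν').symm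
  have ih : Integrable (fun x => (√(f x) - √(f' x)) ^ 2) μ :=
    integrable_sq_sqrt_sub_sqrt Measure.integrable_toReal_rnDeriv
      Measure.integrable_toReal_rnDeriv hf0 hf0'
  set D := ∫ x, Q x ∂ν - ∫ x, Q x ∂ν' with hD
  set S := ∫ x, Q x ^ 2 ∂ν + ∫ x, Q x ^ 2 ∂ν' with hS
  have hS0 : 0 ≤ S := add_nonneg (integral_nonneg fun _ => sq_nonneg _)
    (integral_nonneg fun _ => sq_nonneg _)
  have key : ∀ t : ℝ, 0 ≤ 2 * S * (t * t) + (2 * D) * t + hellingerSq μ ν ν' := by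
    intro t
    have : 2 * S * (t * t) + (2 * D) * t + hellingerSq μ ν ν'
        = ∫ x, ((2 * (t * t)) * (f x * Q x ^ 2 + f' x * Q x ^ 2)
            + (2 * t) * (f x * Q x - f' x * Q x) + (√(f x) - √(f' x)) ^ 2) ∂μ := by
      rw [integral_add _ ih, integral_add, integral_const_mul, integral_const_mul,
        integral_add i2 i2', integral_sub i1 i1', ← e1, ← e1', ← e2, ← e2', hellingerSq]
      · ring
      · exact (i2.add i2').const_mul _
      · exact (i1.sub i1').const_mul _
      · exact ((i2.add i2').const_mul _).add ((i1.sub i1').const_mul _)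
    rw [this]
    refine integral_nonneg fun x => ?_
    have s1 := Real.sq_sqrt (hf0 x)
    have s2 := Real.sq_sqrt (hf0' x)
    simp only [Pi.zero_apply]
    generalize √(f x) = a at s1 ⊢
    generalize √(f' x) = b at s2 ⊢
    rw [← s1, ← s2]
    nlinarith [sq_nonneg (t * Q x * (a + b) + (a - b)), sq_nonneg (t * Q x * (a - b))]
  have := discrim_le_zero key
  rw [discrim] at this
  linarith

/-- Expectations under Hellinger-close measures are close relative to the standard deviations. -/
theorem sq_integral_sub_integral_le_variance (hν : ν ≪ μ) (hν' : ν' ≪ μ) {Q : α → ℝ}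
    (hQ : MemLp Q 2 ν) (hQ' : MemLp Q 2 ν')
    (hH : hellingerSq μ ν ν' ≤ 1 / 4) :
    (∫ x, Q x ∂ν - ∫ x, Q x ∂ν') ^ 2
      ≤ 4 * hellingerSq μ ν ν' * (variance Q ν + variance Q ν') := by
  set q := ∫ x, Q x ∂ν with hq
  set q' := ∫ x, Q x ∂ν' with hq'
  have h := sq_integral_sub_integral_le hν hν' (Q := fun x => Q x - q)
    (hQ.sub (memLp_const q)) (hQ'.sub (memLp_const q))
  have e1 : ∫ x, (Q x - q) ∂ν = 0 := by
    rw [integral_sub (hQ.integrable one_le_two) (integrable_const _)]; simp [hq]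
  have e2 : ∫ x, (Q x - q) ∂ν' = q' - q := by
    rw [integral_sub (hQ'.integrable one_le_two) (integrable_const _)]; simp [hq']
  have e3 : ∫ x, (Q x - q) ^ 2 ∂ν = variance Q ν := (variance_eq_integral hQ.1.aemeasurable).symm
  have e4 : ∫ x, (Q x - q) ^ 2 ∂ν' = variance Q ν' + (q - q') ^ 2 := by
    have a1 : variance (fun x => Q x - q) ν' = ∫ x, (Q x - q) ^ 2 ∂ν' - (∫ x, (Q x - q) ∂ν') ^ 2 :=
      variance_eq_sub (hQ'.sub (memLp_const q))
    rw [variance_sub_const hQ'.1, e2] at a1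
    linarith [a1, sub_sq_comm q q']
  rw [e1, e2, e3, e4] at h
  have hh := hellingerSq_nonneg (μ := μ) (ν := ν) (ν' := ν')
  have : (0 - (q' - q)) ^ 2 = (q - q') ^ 2 := by ring
  rw [this] at h
  -- Centring at `q` leaves an extra `(q - q')²` on the right with factor `2 * hellingerSq ≤ 1/2`,
  -- which is absorbed into the left side.
  nlinarith [sq_nonneg (q - q')]

end Expectation

/-! ### Moments of Gaussian functionals up to order four. -/

section GaussianMoments

/-- Derivatives of a polynomial times `e^{v t² / 2}` keep this form, so the fourth derivative of the
moment generating function follows by iteration. -/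
lemma deriv_mul_exp_sq {v : ℝ} {p p' : ℝ → ℝ} (hp : ∀ t, HasDerivAt p (p' t) t) :
    deriv (fun t => p t * Real.exp (v * t ^ 2 / 2))
      = fun t => (p' t + v * t * p t) * Real.exp (v * t ^ 2 / 2) := by
  ext t
  have h1 : HasDerivAt (fun t : ℝ => v * t ^ 2 / 2) (v * t) t := by
    convert! (((hasDerivAt_id t).pow 2).const_mul v).div_const 2 using 1
    simp; ring
  rw [((hp t).fun_mul h1.exp).deriv]
  ring

lemma integral_pow_four_gaussianReal (v : NNReal) :
    ∫ x, x ^ 4 ∂gaussianReal 0 v = 3 * (v : ℝ) ^ 2 := by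
  have h0 : ∫ x, x ^ 4 ∂gaussianReal 0 v
      = iteratedDeriv 4 (mgf (fun x ↦ x) (gaussianReal 0 v)) 0 := by
    rw [iteratedDeriv_mgf_zero] <;> simp
  rw [h0, mgf_fun_id_gaussianReal, iteratedDeriv_succ, iteratedDeriv_succ, iteratedDeriv_succ,
    iteratedDeriv_one]
  generalize (v : ℝ) = w
  have e0 : (fun t : ℝ => Real.exp (0 * t + w * t ^ 2 / 2))
      = fun t => (fun _ => (1 : ℝ)) t * Real.exp (w * t ^ 2 / 2) := by ext; simp
  have hid : ∀ t : ℝ, HasDerivAt (fun t : ℝ => t) 1 t := hasDerivAt_id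
  have hsq : ∀ t : ℝ, HasDerivAt (fun t : ℝ => t ^ 2) (2 * t) t := fun t => by
    simpa using hasDerivAt_pow 2 t
  have hcu : ∀ t : ℝ, HasDerivAt (fun t : ℝ => t ^ 3) (3 * t ^ 2) t := fun t => by
    simpa using hasDerivAt_pow 3 t
  have d1 := deriv_mul_exp_sq (v := w) (p := fun _ => (1 : ℝ)) (p' := fun _ => 0)
    fun t => hasDerivAt_const t 1
  have d2 := deriv_mul_exp_sq (v := w) (p := fun t => 0 + w * t * 1) (p' := fun _ => w)
    fun t => by simpa using (hid t).const_mul w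
  have d3 := deriv_mul_exp_sq (v := w) (p := fun t => w + w * t * (0 + w * t * 1))
    (p' := fun t => 2 * w ^ 2 * t) fun t => by
      have := ((hsq t).const_mul (w ^ 2)).const_add w
      convert! this using 1
      · ext; simp; ring
      · ring
  have d4 := deriv_mul_exp_sq (v := w)
    (p := fun t => 2 * w ^ 2 * t + w * t * (w + w * t * (0 + w * t * 1)))
    (p' := fun t => 3 * w ^ 2 + 3 * w ^ 3 * t ^ 2) fun t => by
      have := ((hid t).const_mul (3 * w ^ 2)).add ((hcu t).const_mul (w ^ 3))
      convert! this using 1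
      · ext; simp; ring
      · ring
  rw [e0, d1, d2, d3, d4]
  simp

lemma variance_add_le {Ω : Type*} [MeasurableSpace Ω] (ν : Measure Ω) [IsProbabilityMeasure ν] {X Y : Ω → ℝ} (hX : MemLp X 2 ν) (hY : MemLp Y 2 ν) :
    variance (fun x => X x + Y x) ν ≤ 2 * variance X ν + 2 * variance Y ν := by
  have h1 := variance_fun_add hX hY
  have h2 := variance_fun_sub hX hY
  have h3 := variance_nonneg (fun x => X x - Y x) ν
  linarith

variable {H : Type*} [NormedAddCommGroup H] [InnerProductSpace ℝ H] [MeasurableSpace H]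

/-- The centered linear functional `⟪y, x - m⟫`, where `m` is the mean of `ν`. -/
def fluct (ν : Measure H) (y x : H) : ℝ := ⟪y, x - ∫ z, z ∂ν⟫

lemma fluct_add (ν : Measure H) (y y' x : H) : fluct ν (y + y') x = fluct ν y x + fluct ν y' x :=
  inner_add_left _ _ _

lemma fluct_sub (ν : Measure H) (y y' x : H) : fluct ν (y - y') x = fluct ν y x - fluct ν y' x :=
  inner_sub_left _ _ _

lemma fluct_eq_add (ν ν' : Measure H) (y x : H) :
    fluct ν y x = fluct ν' y x + ⟪y, (∫ z, z ∂ν') - ∫ z, z ∂ν⟫ := by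
  rw [fluct, fluct, ← inner_add_right]; congr 1; abel

lemma fluct_eq_sub (ν : Measure H) (y x : H) :
    fluct ν y x = innerSL ℝ y x - ⟪y, ∫ z, z ∂ν⟫ := by
  rw [fluct, inner_sub_right]; rfl

lemma fluct_mul_eq (ν ν' : Measure H) (y y' x : H) :
    fluct ν y x * fluct ν y' x = fluct ν' y x * fluct ν' y' x
      + (⟪y, (∫ z, z ∂ν') - ∫ z, z ∂ν⟫ * fluct ν' y' x
        + ⟪y', (∫ z, z ∂ν') - ∫ z, z ∂ν⟫ * fluct ν' y x)
      + ⟪y, (∫ z, z ∂ν') - ∫ z, z ∂ν⟫ * ⟪y', (∫ z, z ∂ν') - ∫ z, z ∂ν⟫ := by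
  rw [fluct_eq_add ν ν' y, fluct_eq_add ν ν' y']; ring

variable [BorelSpace H]

@[fun_prop]
lemma measurable_fluct (ν : Measure H) (y : H) : Measurable (fluct ν y) := by
  unfold fluct; fun_prop

variable (ν : Measure H) [IsGaussian ν]

lemma memLp_fluct (ρ : Measure H) (y : H) {p : ℝ≥0∞} (hp : p ≠ ∞) : MemLp (fluct ρ y) p ν := by
  have : fluct ρ y = fun x => innerSL ℝ y x - ⟪y, ∫ z, z ∂ρ⟫ := funext (fluct_eq_sub ρ y)
  rw [this]
  exact (IsGaussian.memLp_dual ν (innerSL ℝ y) p hp).sub (memLp_const _)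

lemma memLp_fluct_mul (ρ : Measure H) (y y' : H) {p : ℝ≥0∞} (hp : p ≠ ∞) :
    MemLp (fun x => fluct ρ y x * fluct ρ y' x) p ν := by
  have hp2 : p * 2 ≠ ∞ := ENNReal.mul_ne_top hp (by norm_num)
  have : ENNReal.HolderTriple (p * 2) (p * 2) p := ⟨by
    rw [ENNReal.mul_inv (Or.inr (by norm_num)) (Or.inr (by norm_num)), ← mul_add,
      ENNReal.inv_two_add_inv_two, mul_one]⟩
  exact (memLp_fluct ν ρ y' hp2).mul (memLp_fluct ν ρ y hp2)

variable [SecondCountableTopology H] [CompleteSpace H]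

lemma map_fluct (y : H) :
    ν.map (fluct ν y) = gaussianReal 0 (covarianceBilin ν y y).toNNReal := by
  have h1 : fluct ν y = (fun r : ℝ => r - ⟪y, ∫ z, z ∂ν⟫) ∘ innerSL ℝ y :=
    funext (fluct_eq_sub ν y)
  have h2 : (∫ x, innerSL ℝ y x ∂ν) = ⟪y, ∫ z, z ∂ν⟫ := IsGaussian.integral_dual (innerSL ℝ y)
  rw [h1, ← Measure.map_map (by fun_prop) (by fun_prop), IsGaussian.map_eq_gaussianReal,
    gaussianReal_map_sub_const, h2, sub_self, covarianceBilin_self IsGaussian.memLp_two_id]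
  rfl

lemma integral_fluct (y : H) : ∫ x, fluct ν y x ∂ν = 0 := by
  have : ∫ x, fluct ν y x ∂ν = ∫ r, r ∂(ν.map (fluct ν y)) := by
    rw [integral_map (by fun_prop) (by fun_prop)]
  rw [this, map_fluct, integral_id_gaussianReal]

lemma integral_fluct_pow_four (y : H) :
    ∫ x, fluct ν y x ^ 4 ∂ν = 3 * (covarianceBilin ν y y) ^ 2 := by
  have : ∫ x, fluct ν y x ^ 4 ∂ν = ∫ r, r ^ 4 ∂(ν.map (fluct ν y)) := by
    rw [integral_map (by fun_prop) (by fun_prop)]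
  rw [this, map_fluct, integral_pow_four_gaussianReal,
    Real.coe_toNNReal _ (covarianceBilin_self_nonneg y)]

lemma integral_fluct_mul (y y' : H) :
    ∫ x, fluct ν y x * fluct ν y' x ∂ν = covarianceBilin ν y y' := by
  rw [covarianceBilin_apply IsGaussian.memLp_two_id]
  rfl

/-- Isserlis' formula for products of four centered Gaussian functionals. -/
lemma integral_fluct_mul_mul (a b c d : H) :
    ∫ x, (fluct ν a x * fluct ν b x) * (fluct ν c x * fluct ν d x) ∂ν
      = covarianceBilin ν a b * covarianceBilin ν c d
        + covarianceBilin ν a c * covarianceBilin ν b d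
        + covarianceBilin ν a d * covarianceBilin ν b c := by
  have hi : ∀ y, Integrable (fun x => fluct ν y x ^ 4) ν := fun y => by
    have := (memLp_fluct ν ν y (p := (4 : ℕ)) (by simp)).integrable_norm_pow (by norm_num)
    simpa only [Real.norm_eq_abs, (by decide : Even 4).pow_abs] using this
  -- Polarization: the signed sum of the fourth powers `(a ± b ± c ± d)⁴` over the eight sign
  -- choices is `8 · 4! · abcd`. Only fourth moments of single functionals remain.
  have hpol : ∀ x, (fluct ν a x * fluct ν b x) * (fluct ν c x * fluct ν d x)
      = 1 / 192 * (((fluct ν (a + b + c + d) x ^ 4 - fluct ν (a + b + c - d) x ^ 4)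
        + (fluct ν (a + b - c - d) x ^ 4 - fluct ν (a + b - c + d) x ^ 4))
        + ((fluct ν (a - b + c - d) x ^ 4 - fluct ν (a - b + c + d) x ^ 4)
        + (fluct ν (a - b - c + d) x ^ 4 - fluct ν (a - b - c - d) x ^ 4))) := fun x => by
    simp only [fluct_add, fluct_sub]
    ring
  simp_rw [hpol]
  rw [integral_const_mul, integral_add, integral_add, integral_add, integral_sub, integral_sub,
    integral_sub, integral_sub]
  · simp only [integral_fluct_pow_four, map_add, map_sub, add_apply, sub_apply]
    rw [covarianceBilin_comm b a, covarianceBilin_comm c a, covarianceBilin_comm d a,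
      covarianceBilin_comm c b, covarianceBilin_comm d b, covarianceBilin_comm d c]
    ring
  all_goals first
    | exact hi _
    | exact (hi _).sub (hi _)
    | exact ((hi _).sub (hi _)).add ((hi _).sub (hi _))

lemma covariance_fluct_mul (a b c d : H) :
    cov[fun x => fluct ν a x * fluct ν b x, fun x => fluct ν c x * fluct ν d x; ν]
      = covarianceBilin ν a c * covarianceBilin ν b d
        + covarianceBilin ν a d * covarianceBilin ν b c := by
  rw [covariance_eq_sub (memLp_fluct_mul ν ν a b (by norm_num))
    (memLp_fluct_mul ν ν c d (by norm_num)), integral_fluct_mul, integral_fluct_mul]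
  have := integral_fluct_mul_mul ν a b c d
  simp only [Pi.mul_apply]
  linarith

lemma variance_fluct (y : H) : variance (fluct ν y) ν = covarianceBilin ν y y := by
  rw [variance_eq_sub (memLp_fluct ν ν y (by norm_num)), integral_fluct]
  have := integral_fluct_mul ν y y
  simp only [Pi.pow_apply, pow_two]
  linarith

lemma variance_fluct_sq (y : H) :
    variance (fun x => fluct ν y x * fluct ν y x) ν = 2 * covarianceBilin ν y y ^ 2 := by
  rw [← covariance_self (memLp_fluct_mul ν ν y y (p := 2) (by norm_num)).1.aemeasurable,
    covariance_fluct_mul]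
  ring

/-! ### Variance of quadratic forms in a Gaussian vector. -/

section Quadratic

variable {ι : Type*} [Fintype ι] (y : ι → H) (c : ι → ι → ℝ)

/-- With `Σ` the covariance matrix this is `2 tr((cΣ)²)`: the two Isserlis pairings contribute
equally because `c` is symmetric. -/
lemma variance_sum_fluct_mul (hc : ∀ i j, c i j = c j i) :
    variance (fun x => ∑ p : ι × ι, c p.1 p.2 * (fluct ν (y p.1) x * fluct ν (y p.2) x)) ν
      = 2 * ∑ j, ∑ k, (∑ i, c i j * covarianceBilin ν (y i) (y k))
          * (∑ i, c i k * covarianceBilin ν (y i) (y j)) := by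
  rw [variance_fun_sum fun p => (memLp_fluct_mul ν ν _ _ (by norm_num)).const_mul _]
  simp_rw [covariance_const_mul_left, covariance_const_mul_right, covariance_fluct_mul,
    Fintype.sum_prod_type, Finset.sum_mul_sum]
  set b : ι → ι → ℝ := fun i j => covarianceBilin ν (y i) (y j) with hb
  have hbs : ∀ i j, b i j = b j i := fun i j => covarianceBilin_comm _ _
  have e1 : ∀ i j k l, c i j * (c k l * (b i k * b j l + b i l * b j k))
      = (c i j * b i k) * (c l k * b l j) + (c i j * b i l) * (c k l * b k j) := by
    intro i j k l
    rw [hc l k, hbs l j, hbs k j]; ring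
  simp only [hb] at e1
  simp_rw [e1, Finset.sum_add_distrib]
  rw [two_mul]
  congr 1
  · rw [Finset.sum_comm]
    refine Finset.sum_congr rfl fun j _ => ?_
    rw [Finset.sum_comm]
  · rw [Finset.sum_comm]
    refine Finset.sum_congr rfl fun j _ => ?_
    rw [Finset.sum_comm]
    conv_rhs => rw [Finset.sum_comm]
    rw [Finset.sum_comm]
    refine Finset.sum_congr rfl fun i _ => ?_
    rw [Finset.sum_comm]

variable {E : Type*} [NormedAddCommGroup E] [InnerProductSpace ℝ E]

omit [Fintype ι] in
lemma sum_apply_inner_le {z : ι → E} (hz : Orthonormal ℝ z) (B : E →L[ℝ] E) {M : ℝ}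
    (hB : ‖B‖ ≤ M) (w : E) (s : Finset ι) : ∑ k ∈ s, ⟪B w, z k⟫ ^ 2 ≤ M ^ 2 * ‖w‖ ^ 2 := by
  have h1 := hz.sum_inner_products_le (B w) (s := s)
  simp only [Real.norm_eq_abs, sq_abs, real_inner_comm (B w)] at h1
  rw [← mul_pow]
  exact h1.trans (pow_le_pow_left₀ (norm_nonneg _) (B.le_of_opNorm_le hB w) 2)

lemma norm_sq_sum_smul {z : ι → E} (hz : Orthonormal ℝ z) (a : ι → ℝ) :
    ‖∑ i, a i • z i‖ ^ 2 = ∑ i, a i ^ 2 := by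
  rw [← real_inner_self_eq_norm_sq, hz.inner_sum]
  simp [pow_two]

variable {ν} {y c}

/-- For `X = cΣ`, `tr(X²)` is at most the squared Hilbert–Schmidt norm of `X`. Each row of `X`
consists of coordinates of `B` applied to `∑ i, c i j • z i`, so Bessel's inequality gives a
constant depending on `M` but not on the number of coordinates. -/
lemma variance_sum_fluct_mul_le (hc : ∀ i j, c i j = c j i) {z : ι → E} (hz : Orthonormal ℝ z)
    {B : E →L[ℝ] E} {M : ℝ} (hB : ‖B‖ ≤ M)
    (hcov : ∀ i j, covarianceBilin ν (y i) (y j) = ⟪B (z i), z j⟫) :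
    variance (fun x => ∑ p : ι × ι, c p.1 p.2 * (fluct ν (y p.1) x * fluct ν (y p.2) x)) ν
      ≤ 2 * M ^ 2 * ∑ i, ∑ j, c i j ^ 2 := by
  rw [variance_sum_fluct_mul ν y c hc]
  set X : ι → ι → ℝ := fun j k => ∑ i, c i j * covarianceBilin ν (y i) (y k) with hX
  have h1 : ∑ j, ∑ k, X j k * X k j ≤ ∑ j, ∑ k, X j k ^ 2 := by
    have e1 : ∑ j, ∑ k, X k j ^ 2 = ∑ j, ∑ k, X j k ^ 2 := Finset.sum_comm
    have e2 : ∑ j, ∑ k, X j k * X k j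
        ≤ ∑ j, ∑ k, (1 / 2 * X j k ^ 2 + 1 / 2 * X k j ^ 2) := by
      gcongr with j _ k _
      nlinarith [sq_nonneg (X j k - X k j)]
    simp_rw [Finset.sum_add_distrib, ← Finset.mul_sum] at e2
    linarith
  have h2 : ∀ j, ∑ k, X j k ^ 2 ≤ M ^ 2 * ∑ i, c i j ^ 2 := fun j => by
    rw [← norm_sq_sum_smul hz (fun i => c i j)]
    convert! sum_apply_inner_le hz B hB (∑ i, c i j • z i) Finset.univ using 3 with k
    simp only [hX, hcov, map_sum, map_smul, sum_inner, real_inner_smul_left]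
  have h3 : ∑ j, ∑ k, X j k ^ 2 ≤ M ^ 2 * ∑ i, ∑ j, c i j ^ 2 := by
    rw [Finset.sum_comm (f := fun i j => c i j ^ 2), Finset.mul_sum]
    exact Finset.sum_le_sum fun j _ => h2 j
  change 2 * ∑ j, ∑ k, X j k * X k j ≤ _
  linarith

end Quadratic

/-! ### Means and covariances of Hellinger-close Gaussian measures. -/

section Comparison

variable {ν} {ν' μ : Measure H} [IsGaussian ν'] [IsFiniteMeasure μ]

/-- The means of two Hellinger-close Gaussian measures are close. -/
lemma sq_inner_mean_sub_le (hν : ν ≪ μ) (hν' : ν' ≪ μ) (hH : hellingerSq μ ν ν' ≤ 1 / 4) (y : H) :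
    ⟪y, (∫ z, z ∂ν') - ∫ z, z ∂ν⟫ ^ 2
      ≤ 4 * hellingerSq μ ν ν' * (covarianceBilin ν y y + covarianceBilin ν' y y) := by
  have h := sq_integral_sub_integral_le_variance hν hν' (memLp_fluct ν ν y (by norm_num))
    (memLp_fluct ν' ν y (by norm_num)) hH
  have e1 : fluct ν y = fun x => fluct ν' y x + ⟪y, (∫ z, z ∂ν') - ∫ z, z ∂ν⟫ :=
    funext (fluct_eq_add ν ν' y)
  have e2 : ∫ x, fluct ν y x ∂ν' = ⟪y, (∫ z, z ∂ν') - ∫ z, z ∂ν⟫ := by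
    rw [e1, integral_add ((memLp_fluct ν' ν' y (p := 1) (by norm_num)).integrable le_rfl)
      (integrable_const _), integral_fluct]
    simp
  have e3 : variance (fluct ν y) ν' = covarianceBilin ν' y y := by
    rw [e1, variance_add_const (memLp_fluct ν' ν' y (p := 1) (by norm_num)).1, variance_fluct]
  rw [integral_fluct, e2, e3, variance_fluct] at h
  linarith [h, sub_sq_comm 0 ⟪y, (∫ z, z ∂ν') - ∫ z, z ∂ν⟫]

omit [IsGaussian ν] in
lemma integral_fluct_mul_other (y y' : H) :
    ∫ x, fluct ν y x * fluct ν y' x ∂ν' = covarianceBilin ν' y y'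
      + ⟪y, (∫ z, z ∂ν') - ∫ z, z ∂ν⟫ * ⟪y', (∫ z, z ∂ν') - ∫ z, z ∂ν⟫ := by
  have i1 : ∀ u, Integrable (fluct ν' u) ν' := fun u =>
    (memLp_fluct ν' ν' u (p := 1) (by norm_num)).integrable le_rfl
  have i2 : Integrable (fun x => fluct ν' y x * fluct ν' y' x) ν' :=
    (memLp_fluct_mul ν' ν' y y' (p := 1) (by norm_num)).integrable le_rfl
  simp_rw [fluct_mul_eq ν ν']
  rw [integral_add _ (integrable_const _), integral_add i2, integral_add, integral_const_mul,
    integral_const_mul, integral_fluct, integral_fluct, integral_fluct_mul]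
  · simp
  · exact (i1 _).const_mul _
  · exact (i1 _).const_mul _
  · exact ((i1 _).const_mul _).add ((i1 _).const_mul _)
  · exact i2.add (((i1 _).const_mul _).add ((i1 _).const_mul _))

/-- The variances of two Hellinger-close Gaussian measures are comparable. -/
lemma covarianceBilin_le_two_mul (hν : ν ≪ μ) (hν' : ν' ≪ μ)
    (hH : hellingerSq μ ν ν' ≤ 1 / 1000) (y : H) :
    covarianceBilin ν' y y ≤ 2 * covarianceBilin ν y y := by
  have hmean := sq_inner_mean_sub_le hν hν' (hH.trans (by norm_num)) y
  have h := sq_integral_sub_integral_le_variance hν hν' (memLp_fluct_mul ν ν y y (by norm_num))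
    (memLp_fluct_mul ν' ν y y (by norm_num)) (hH.trans (by norm_num))
  rw [integral_fluct_mul, integral_fluct_mul_other, variance_fluct_sq] at h
  set a := ⟪y, (∫ z, z ∂ν') - ∫ z, z ∂ν⟫ with ha
  set s := covarianceBilin ν y y with hs
  set s' := covarianceBilin ν' y y with hs'
  set t := hellingerSq μ ν ν' with ht
  have ht0 : 0 ≤ t := hellingerSq_nonneg
  have hs0 : 0 ≤ s := covarianceBilin_self_nonneg y
  have hs0' : 0 ≤ s' := covarianceBilin_self_nonneg y
  have hv : variance (fun x => fluct ν y x * fluct ν y x) ν' ≤ 4 * s' ^ 2 + 8 * a ^ 2 * s' := by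
    have e1 : (fun x => fluct ν y x * fluct ν y x)
        = fun x => (fluct ν' y x * fluct ν' y x + (2 * a) * fluct ν' y x) + a * a := by
      ext x; rw [fluct_mul_eq ν ν']; ring
    have m1 := memLp_fluct_mul ν' ν' y y (p := 2) (by norm_num)
    have m2 : MemLp (fun x => (2 * a) * fluct ν' y x) 2 ν' :=
      (memLp_fluct ν' ν' y (p := 2) (by norm_num)).const_mul _
    have m3 : AEStronglyMeasurable
        (fun x => fluct ν' y x * fluct ν' y x + (2 * a) * fluct ν' y x) ν' := (m1.add m2).1
    rw [e1, variance_add_const m3]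
    refine (variance_add_le ν' m1 m2).trans ?_
    rw [variance_fluct_sq, variance_const_mul, variance_fluct]
    linarith
  -- If `s' > 2 s`, the mean bound gives `a² ≤ s'`. Then the squared difference of the expectations
  -- is at least `(s'/2)²`, while its upper bound is at most `s'²/20`.
  by_contra! hlt
  have hs1 : 0 < s' := by linarith
  have ha2 : a ^ 2 ≤ s' := by
    have : 4 * t * (s + s') ≤ 4 * (1 / 1000) * (s + s') := by gcongr
    linarith
  have h1 : (s - (s' + a * a)) ^ 2 ≤ 4 * (1 / 1000) * (2 * s ^ 2 + (4 * s' ^ 2 + 8 * s' * s')) := by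
    have h2 : 4 * s' ^ 2 + 8 * a ^ 2 * s' ≤ 4 * s' ^ 2 + 8 * s' * s' := by gcongr
    calc _ ≤ _ := h
      _ ≤ 4 * t * (2 * s ^ 2 + (4 * s' ^ 2 + 8 * s' * s')) := by gcongr; exact hv.trans h2
      _ ≤ _ := by gcongr
  nlinarith [mul_self_nonneg a]

variable {ι : Type*} [Fintype ι] {E : Type*} [NormedAddCommGroup E] [InnerProductSpace ℝ E]
  {y : ι → H} {z : ι → E} {B B' : E →L[ℝ] E} {M : ℝ}

omit [IsGaussian ν] [SecondCountableTopology H] [CompleteSpace H] in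
lemma covarianceBilin_sum_smul_le (hz : Orthonormal ℝ z) (hB : ‖B‖ ≤ M)
    (hcov : ∀ i j, covarianceBilin ν (y i) (y j) = ⟪B (z i), z j⟫) (a : ι → ℝ) :
    covarianceBilin ν (∑ i, a i • y i) (∑ i, a i • y i) ≤ M * ∑ i, a i ^ 2 := by
  have e : covarianceBilin ν (∑ i, a i • y i) (∑ i, a i • y i)
      = ⟪B (∑ i, a i • z i), ∑ i, a i • z i⟫ := by
    simp only [map_sum, map_smul, sum_apply, smul_apply, hcov, sum_inner, inner_sum,
      real_inner_smul_left, real_inner_smul_right, smul_eq_mul, Finset.mul_sum]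
  rw [e, ← norm_sq_sum_smul hz, pow_two, ← mul_assoc]
  refine (real_inner_le_norm _ _).trans ?_
  gcongr
  exact B.le_of_opNorm_le hB _

/-- The mean difference is tested against the vector built from its own coordinates, `∑ i, a i • y
i`; one factor `∑ a i ^ 2` then cancels. -/
lemma sum_sq_mean_sub_le (hν : ν ≪ μ) (hν' : ν' ≪ μ) (hH : hellingerSq μ ν ν' ≤ 1 / 4)
    (hz : Orthonormal ℝ z) (hB : ‖B‖ ≤ M) (hB' : ‖B'‖ ≤ M)
    (hcov : ∀ i j, covarianceBilin ν (y i) (y j) = ⟪B (z i), z j⟫)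
    (hcov' : ∀ i j, covarianceBilin ν' (y i) (y j) = ⟪B' (z i), z j⟫) :
    ∑ i, ⟪y i, (∫ z, z ∂ν') - ∫ z, z ∂ν⟫ ^ 2 ≤ 8 * hellingerSq μ ν ν' * M := by
  set a : ι → ℝ := fun i => ⟪y i, (∫ z, z ∂ν') - ∫ z, z ∂ν⟫ with ha
  have h := sq_inner_mean_sub_le hν hν' hH (∑ i, a i • y i)
  have h1 := covarianceBilin_sum_smul_le (ν := ν) hz hB hcov a
  have h2 := covarianceBilin_sum_smul_le (ν := ν') hz hB' hcov' a
  have e : ⟪∑ i, a i • y i, (∫ z, z ∂ν') - ∫ z, z ∂ν⟫ = ∑ i, a i ^ 2 := by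
    simp only [sum_inner, real_inner_smul_left, pow_two]; rfl
  rw [e] at h
  have ht0 : 0 ≤ hellingerSq μ ν ν' := hellingerSq_nonneg
  have hM : 0 ≤ M := (norm_nonneg _).trans hB
  rcases (Finset.sum_nonneg fun i _ => sq_nonneg (a i) : 0 ≤ ∑ i, a i ^ 2).eq_or_lt with h0 | h0
  · change ∑ i, a i ^ 2 ≤ _
    rw [← h0]; positivity
  · refine le_of_mul_le_mul_right ?_ h0
    calc (∑ i, a i ^ 2) * ∑ i, a i ^ 2 = (∑ i, a i ^ 2) ^ 2 := (pow_two _).symm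
      _ ≤ _ := h
      _ ≤ 4 * hellingerSq μ ν ν' * (M * ∑ i, a i ^ 2 + M * ∑ i, a i ^ 2) := by gcongr
      _ = _ := by ring

/-- Scalar end of `sum_sq_covariance_sub_le`: `N` is the squared norm of the covariance difference,
`A` that of the mean difference, `K` their cross term. `K` is removed by `N² ≤ 2 (N + K)² + 2 K²`,
and a factor `N` cancels. -/
lemma le_of_quadratic_bounds {N K t A V V' : ℝ} (hN : 0 ≤ N) (ht : 0 ≤ t) (ht1 : t ≤ 1 / 1000)
    (hM : 0 ≤ M) (hA0 : 0 ≤ A) (hA : A ≤ 8 * t * M) (h : (N + K) ^ 2 ≤ 4 * t * (V + V'))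
    (hV : V ≤ 2 * M ^ 2 * N) (hV' : V' ≤ 4 * M ^ 2 * N + 8 * M * (N * A))
    (hK : K ^ 2 ≤ N * A ^ 2) : N ≤ 64 * t * M ^ 2 := by
  have h6 : (N + K) ^ 2 ≤ 4 * t * (2 * M ^ 2 * N + (4 * M ^ 2 * N + 8 * M * (N * (8 * t * M)))) := by
    have h5 : 8 * M * (N * A) ≤ 8 * M * (N * (8 * t * M)) := by gcongr
    refine h.trans (mul_le_mul_of_nonneg_left ?_ (by positivity))
    linarith
  have h8 : K ^ 2 ≤ N * (8 * t * M) ^ 2 := hK.trans (by gcongr)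
  have h9 : N ^ 2 ≤ 2 * (N + K) ^ 2 + 2 * K ^ 2 := by linarith [sq_nonneg (N + 2 * K)]
  have h11 : t * (t * M ^ 2 * N) ≤ 1 / 1000 * (t * M ^ 2 * N) := by gcongr
  have h12 : 0 ≤ t * M ^ 2 * N := by positivity
  have h10 : N * N ≤ (64 * t * M ^ 2) * N := by
    calc N * N ≤ 48 * (t * M ^ 2 * N) + 640 * (t * (t * M ^ 2 * N)) := by linarith
      _ ≤ 64 * (t * M ^ 2 * N) := by linarith
      _ = _ := by ring
  rcases hN.eq_or_lt with h0 | h0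
  · rw [← h0]; positivity
  · exact le_of_mul_le_mul_right h10 h0

/-- The covariances of two Hellinger-close Gaussian measures are close in the Hilbert–Schmidt
sense, uniformly in the number of coordinates. -/
theorem sum_sq_covariance_sub_le (hν : ν ≪ μ) (hν' : ν' ≪ μ)
    (hH : hellingerSq μ ν ν' ≤ 1 / 1000)
    (hz : Orthonormal ℝ z) (hB : ‖B‖ ≤ M) (hB' : ‖B'‖ ≤ M)
    (hcov : ∀ i j, covarianceBilin ν (y i) (y j) = ⟪B (z i), z j⟫)
    (hcov' : ∀ i j, covarianceBilin ν' (y i) (y j) = ⟪B' (z i), z j⟫) :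
    ∑ i, ∑ j, ⟪(B' - B) (z i), z j⟫ ^ 2 ≤ 64 * hellingerSq μ ν ν' * M ^ 2 := by
  have hA := sum_sq_mean_sub_le hν hν' (hH.trans (by norm_num)) hz hB hB' hcov hcov'
  set c : ι → ι → ℝ := fun i j => ⟪(B' - B) (z i), z j⟫ with hcdef
  set a : ι → ℝ := fun i => ⟪y i, (∫ z, z ∂ν') - ∫ z, z ∂ν⟫ with ha
  have hcsub : ∀ i j, c i j = covarianceBilin ν' (y i) (y j) - covarianceBilin ν (y i) (y j) :=
    fun i j => by rw [hcov, hcov', hcdef, ← inner_sub_left]; rfl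
  have hc : ∀ i j, c i j = c j i := fun i j => by
    rw [hcsub, hcsub, covarianceBilin_comm, covarianceBilin_comm (y i)]
  set t := hellingerSq μ ν ν' with ht
  have ht0 : 0 ≤ t := hellingerSq_nonneg
  have hM : 0 ≤ M := (norm_nonneg _).trans hB
  set N := ∑ i, ∑ j, c i j ^ 2 with hN
  have hN0 : 0 ≤ N := Finset.sum_nonneg fun i _ => Finset.sum_nonneg fun j _ => sq_nonneg _
  -- The covariance difference is tested against itself: its entries are the coefficients of `Q`, so
  -- the expectations differ by `N` up to the mean correction `K`.
  set Q : H → ℝ := fun x => ∑ p : ι × ι, c p.1 p.2 * (fluct ν (y p.1) x * fluct ν (y p.2) x)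
    with hQ
  set Q' : H → ℝ := fun x => ∑ p : ι × ι, c p.1 p.2 * (fluct ν' (y p.1) x * fluct ν' (y p.2) x)
    with hQ'
  have mQ : ∀ (ρ ρ' : Measure H) [IsGaussian ρ], MemLp (fun x => ∑ p : ι × ι,
      c p.1 p.2 * (fluct ρ' (y p.1) x * fluct ρ' (y p.2) x)) 2 ρ := fun ρ ρ' _ =>
    memLp_finsetSum _ fun p _ => (memLp_fluct_mul ρ ρ' _ _ (by norm_num)).const_mul _
  have h := sq_integral_sub_integral_le_variance hν hν' (mQ ν ν) (mQ ν' ν)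
    (hH.trans (by norm_num))
  have iQ : ∀ (ρ : Measure H) [IsGaussian ρ] (p : ι × ι), Integrable
      (fun x => c p.1 p.2 * (fluct ν (y p.1) x * fluct ν (y p.2) x)) ρ := fun ρ _ p =>
    ((memLp_fluct_mul ρ ν _ _ (p := 1) (by norm_num)).integrable le_rfl).const_mul _
  have e1 : ∫ x, Q x ∂ν = ∑ i, ∑ j, c i j * covarianceBilin ν (y i) (y j) := by
    rw [hQ, integral_finsetSum _ fun p _ => iQ ν p, Fintype.sum_prod_type]
    simp_rw [integral_const_mul, integral_fluct_mul]
  have e2 : ∫ x, Q x ∂ν' = ∑ i, ∑ j, c i j * (covarianceBilin ν' (y i) (y j) + a i * a j) := by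
    rw [hQ, integral_finsetSum _ fun p _ => iQ ν' p, Fintype.sum_prod_type]
    simp_rw [integral_const_mul, integral_fluct_mul_other]
    rfl
  set K := ∑ i, ∑ j, c i j * (a i * a j) with hK
  have e3 : ∫ x, Q x ∂ν - ∫ x, Q x ∂ν' = -(N + K) := by
    rw [e1, e2, hN, hK, ← Finset.sum_add_distrib, ← Finset.sum_sub_distrib, ← Finset.sum_neg_distrib]
    refine Finset.sum_congr rfl fun i _ => ?_
    rw [← Finset.sum_add_distrib, ← Finset.sum_sub_distrib, ← Finset.sum_neg_distrib]
    refine Finset.sum_congr rfl fun j _ => ?_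
    have := hcsub i j
    have e4 : covarianceBilin ν' (y i) (y j) = c i j + covarianceBilin ν (y i) (y j) := by linarith
    rw [e4]; ring
  have hv1 : variance Q ν ≤ 2 * M ^ 2 * N := variance_sum_fluct_mul_le hc hz hB hcov
  have hv2 : variance Q' ν' ≤ 2 * M ^ 2 * N := variance_sum_fluct_mul_le hc hz hB' hcov'
  set b : ι → ℝ := fun j => ∑ i, c i j * a i with hb
  set A := ∑ i, a i ^ 2 with hAdef
  have hA0 : 0 ≤ A := Finset.sum_nonneg fun i _ => sq_nonneg _
  have hbN : ∑ j, b j ^ 2 ≤ N * A := by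
    rw [hN, Finset.sum_comm, Finset.sum_mul]
    exact Finset.sum_le_sum fun j _ => Finset.sum_mul_sq_le_sq_mul_sq _ _ _
  have hKN : K ^ 2 ≤ N * A ^ 2 := by
    have : K = ∑ j, b j * a j := by
      rw [hK, Finset.sum_comm]
      refine Finset.sum_congr rfl fun j _ => ?_
      rw [hb, Finset.sum_mul]
      exact Finset.sum_congr rfl fun i _ => by ring
    rw [this]
    refine (Finset.sum_mul_sq_le_sq_mul_sq _ _ _).trans ?_
    rw [pow_two A, ← mul_assoc]
    gcongr
  set w : H := ∑ j, b j • y j with hw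
  have hfw : ∀ x, fluct ν' w x = ∑ j, b j * fluct ν' (y j) x := fun x => by
    simp only [fluct, hw, sum_inner, real_inner_smul_left]
  -- Recentring `Q` at the mean of `ν'` adds a linear functional along `w` and a constant; only the
  -- linear part adds to the variance.
  have eQ : Q = fun x => (Q' x + 2 * fluct ν' w x) + K := by
    ext x
    have s1 : ∑ p : ι × ι, c p.1 p.2 * (a p.1 * fluct ν' (y p.2) x) = fluct ν' w x := by
      rw [Fintype.sum_prod_type, Finset.sum_comm, hfw]
      refine Finset.sum_congr rfl fun j _ => ?_
      rw [hb, Finset.sum_mul]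
      exact Finset.sum_congr rfl fun i _ => by ring
    have s2 : ∑ p : ι × ι, c p.1 p.2 * (a p.2 * fluct ν' (y p.1) x) = fluct ν' w x := by
      rw [Fintype.sum_prod_type, hfw]
      refine Finset.sum_congr rfl fun j _ => ?_
      rw [hb, Finset.sum_mul]
      exact Finset.sum_congr rfl fun i _ => by simp only [hc j i]; ring
    have s3 : ∑ p : ι × ι, c p.1 p.2 * (a p.1 * a p.2) = K := by
      rw [Fintype.sum_prod_type]
    have s4 : Q x = Q' x + (∑ p : ι × ι, c p.1 p.2 * (a p.1 * fluct ν' (y p.2) x)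
        + ∑ p : ι × ι, c p.1 p.2 * (a p.2 * fluct ν' (y p.1) x))
        + ∑ p : ι × ι, c p.1 p.2 * (a p.1 * a p.2) := by
      simp only [hQ, hQ', ← Finset.sum_add_distrib]
      refine Finset.sum_congr rfl fun p _ => ?_
      rw [fluct_mul_eq ν ν']
      ring
    rw [s4, s1, s2, s3]; ring
  have hv3 : variance Q ν' ≤ 4 * M ^ 2 * N + 8 * M * (N * A) := by
    have m2 : MemLp (fun x => 2 * fluct ν' w x) 2 ν' :=
      (memLp_fluct ν' ν' w (p := 2) (by norm_num)).const_mul _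
    have m3 : AEStronglyMeasurable (fun x => Q' x + 2 * fluct ν' w x) ν' :=
      ((mQ ν' ν').add m2).1
    rw [eQ, variance_add_const m3]
    refine (variance_add_le ν' (mQ ν' ν') m2).trans ?_
    rw [variance_const_mul, variance_fluct]
    have := covarianceBilin_sum_smul_le (ν := ν') hz hB' hcov' b
    have h5 : M * ∑ j, b j ^ 2 ≤ M * (N * A) := by gcongr
    linarith
  have h6 : (N + K) ^ 2 ≤ 4 * t * (variance Q ν + variance Q ν') := by
    have e7 : (-(N + K)) ^ 2 = (N + K) ^ 2 := by ring
    rw [← e7, ← e3]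
    exact h
  exact le_of_quadratic_bounds hN0 ht0 hH hM hA0 hA h6 hv1 hv3 hKN

end Comparison

end GaussianMoments

/-! ### Hilbert–Schmidt operators: completeness and compactness. -/

section HilbertSchmidtNorm

variable {E F : Type*} [NormedAddCommGroup E] [InnerProductSpace ℝ E]
  [NormedAddCommGroup F] [NormedSpace ℝ F]

lemma sum_enorm_sq_eq_ofReal (T : E →L[ℝ] F) (s : Finset E) :
    ∑ e ∈ s, ‖T e‖ₑ ^ 2 = ENNReal.ofReal (∑ e ∈ s, ‖T e‖ ^ 2) := by
  rw [ENNReal.ofReal_sum_of_nonneg fun _ _ => sq_nonneg _]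
  refine Finset.sum_congr rfl fun e _ => ?_
  rw [ENNReal.ofReal_pow (norm_nonneg _), ofReal_norm]

lemma hsNorm_le_ofReal_iff {T : E →L[ℝ] F} {K : ℝ} (hK : 0 ≤ K) :
    hsNorm T ≤ ENNReal.ofReal K ↔
      ∀ s : Finset E, Orthonormal ℝ ((↑) : s → E) → ∑ e ∈ s, ‖T e‖ ^ 2 ≤ K ^ 2 := by
  have h1 : ENNReal.ofReal K = (ENNReal.ofReal (K ^ 2)) ^ (1 / 2 : ℝ) := by
    rw [ENNReal.ofReal_rpow_of_nonneg (sq_nonneg K) (by norm_num), ← Real.sqrt_eq_rpow,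
      Real.sqrt_sq hK]
  rw [hsNorm, h1, ENNReal.rpow_le_rpow_iff (by norm_num)]
  simp only [iSup_le_iff, sum_enorm_sq_eq_ofReal]
  refine forall₂_congr fun s _ => ?_
  rw [ENNReal.ofReal_le_ofReal_iff (sq_nonneg K)]

lemma IsHilbertSchmidt.exists_bound {T : E →L[ℝ] F} (hT : IsHilbertSchmidt T) :
    ∃ K : ℝ, 0 ≤ K ∧
      ∀ s : Finset E, Orthonormal ℝ ((↑) : s → E) → ∑ e ∈ s, ‖T e‖ ^ 2 ≤ K ^ 2 :=
  ⟨(hsNorm T).toReal, ENNReal.toReal_nonneg, (hsNorm_le_ofReal_iff ENNReal.toReal_nonneg).1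
    (ENNReal.ofReal_toReal hT.ne).ge⟩

lemma isHilbertSchmidt_of_bound {T : E →L[ℝ] F} {K : ℝ} (hK : 0 ≤ K)
    (h : ∀ s : Finset E, Orthonormal ℝ ((↑) : s → E) → ∑ e ∈ s, ‖T e‖ ^ 2 ≤ K ^ 2) :
    IsHilbertSchmidt T :=
  ((hsNorm_le_ofReal_iff hK).2 h).trans_lt ENNReal.ofReal_lt_top

lemma norm_le_of_sum_sq_le {T : E →L[ℝ] F} {K : ℝ} (hK : 0 ≤ K)
    (h : ∀ s : Finset E, Orthonormal ℝ ((↑) : s → E) → ∑ e ∈ s, ‖T e‖ ^ 2 ≤ K ^ 2) :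
    ‖T‖ ≤ K := by
  refine T.opNorm_le_of_unit_norm hK fun e he => ?_
  have ho : Orthonormal ℝ ((↑) : ({e} : Finset E) → E) := by
    refine ⟨fun i => ?_, fun i j hij => ?_⟩
    · rw [Finset.mem_singleton.1 i.2, he]
    · exact absurd (Subtype.ext ((Finset.mem_singleton.1 i.2).trans
        (Finset.mem_singleton.1 j.2).symm)) hij
  have := h {e} ho
  rw [Finset.sum_singleton] at this
  exact le_of_sq_le_sq this hK

/-- A sequence of operators that is Cauchy in the Hilbert–Schmidt norm converges in this norm. -/
theorem exists_tendsto_hsNorm [CompleteSpace F] {T : ℕ → E →L[ℝ] F}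
    (h : ∀ ε : ℝ, 0 < ε → ∃ N, ∀ n ≥ N, ∀ k ≥ N, ∀ s : Finset E, Orthonormal ℝ ((↑) : s → E) →
      ∑ e ∈ s, ‖(T n - T k) e‖ ^ 2 ≤ ε ^ 2) :
    ∃ T₀ : E →L[ℝ] F, Tendsto T atTop (𝓝 T₀) ∧ Tendsto (fun n => hsNorm (T n - T₀)) atTop (𝓝 0) := by
  have hc : CauchySeq T := by
    refine Metric.cauchySeq_iff.2 fun ε hε => ?_
    obtain ⟨N, hN⟩ := h (ε / 2) (half_pos hε)
    refine ⟨N, fun n hn k hk => ?_⟩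
    rw [dist_eq_norm]
    exact (norm_le_of_sum_sq_le (half_pos hε).le (hN n hn k hk)).trans_lt (half_lt_self hε)
  obtain ⟨T₀, hT₀⟩ := cauchySeq_tendsto_of_complete hc
  refine ⟨T₀, hT₀, ENNReal.tendsto_nhds_zero.2 fun ε hε => ?_⟩
  obtain ⟨δ, hδ, hδε⟩ := ENNReal.lt_iff_exists_real_btwn.1 hε
  have hδ0 : 0 < δ := ENNReal.ofReal_pos.1 hδε.1
  obtain ⟨N, hN⟩ := h δ hδ0
  filter_upwards [eventually_ge_atTop N] with n hn
  refine ((hsNorm_le_ofReal_iff hδ0.le).2 fun s hs => ?_).trans hδε.2.le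
  have hlim : Tendsto (fun k => ∑ e ∈ s, ‖(T n - T k) e‖ ^ 2) atTop
      (𝓝 (∑ e ∈ s, ‖(T n - T₀) e‖ ^ 2)) := by
    refine tendsto_finsetSum _ fun e _ => ?_
    have : Tendsto (fun k => (T n - T k) e) atTop (𝓝 ((T n - T₀) e)) :=
      ((ContinuousLinearMap.apply ℝ F e).continuous.tendsto _).comp (hT₀.const_sub (T n))
    exact this.norm.pow 2
  refine le_of_tendsto hlim ?_
  filter_upwards [eventually_ge_atTop N] with k hk using hN n hn k hk s hs

lemma isHilbertSchmidt_of_hsNorm_sub_lt_top {S T : E →L[ℝ] F} (hS : IsHilbertSchmidt S)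
    (h : hsNorm (S - T) < ∞) : IsHilbertSchmidt T := by
  obtain ⟨K, hK, hKs⟩ := hS.exists_bound
  obtain ⟨L, hL, hLs⟩ := IsHilbertSchmidt.exists_bound h
  refine isHilbertSchmidt_of_bound (K := √(2 * K ^ 2 + 2 * L ^ 2)) (Real.sqrt_nonneg _)
    fun s hs => ?_
  rw [Real.sq_sqrt (by positivity)]
  calc ∑ e ∈ s, ‖T e‖ ^ 2 ≤ ∑ e ∈ s, (2 * ‖S e‖ ^ 2 + 2 * ‖(S - T) e‖ ^ 2) := by
        refine Finset.sum_le_sum fun e _ => ?_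
        have h1 : ‖T e‖ ≤ ‖S e‖ + ‖(S - T) e‖ := by
          have : T e = S e - (S - T) e := by simp
          rw [this]; exact norm_sub_le _ _
        nlinarith [sq_nonneg (‖S e‖ - ‖(S - T) e‖), norm_nonneg (T e)]
    _ = 2 * ∑ e ∈ s, ‖S e‖ ^ 2 + 2 * ∑ e ∈ s, ‖(S - T) e‖ ^ 2 := by
        rw [Finset.sum_add_distrib, Finset.mul_sum, Finset.mul_sum]
    _ ≤ _ := by linarith [hKs s hs, hLs s hs]

lemma orthonormal_insert [DecidableEq E] {s : Finset E} (hs : Orthonormal ℝ ((↑) : s → E)) {v : E} (hv : ‖v‖ = 1)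
    (hvs : ∀ e ∈ s, ⟪e, v⟫ = 0) :
    Orthonormal ℝ ((↑) : ↥(insert v s) → E) := by
  refine ⟨fun i => ?_, fun i j hij => ?_⟩
  · rcases Finset.mem_insert.1 i.2 with h | h
    · rw [h, hv]
    · exact hs.1 ⟨_, h⟩
  · have hij' : (i : E) ≠ j := fun h => hij (Subtype.ext h)
    rcases Finset.mem_insert.1 i.2 with h | h <;> rcases Finset.mem_insert.1 j.2 with h' | h'
    · exact absurd (h.trans h'.symm) hij'
    · change ⟪(i : E), j⟫ = 0
      rw [h, real_inner_comm]; exact hvs _ h'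
    · change ⟪(i : E), j⟫ = 0
      rw [h']; exact hvs _ h
    · exact hs.2 (i := ⟨_, h⟩) (j := ⟨_, h'⟩) fun e => hij' (Subtype.mk.inj e)

/-- Hilbert–Schmidt operators are compact. -/
theorem IsHilbertSchmidt.isCompactOperator [CompleteSpace F] {T : E →L[ℝ] F}
    (hT : IsHilbertSchmidt T) : IsCompactOperator T := by
  classical
  obtain ⟨K, hK, hKs⟩ := hT.exists_bound
  set A : Set ℝ := {r | ∃ s : Finset E, Orthonormal ℝ ((↑) : s → E) ∧ r = ∑ e ∈ s, ‖T e‖ ^ 2}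
    with hA
  have hAb : BddAbove A := ⟨K ^ 2, by rintro _ ⟨s, hs, rfl⟩; exact hKs s hs⟩
  have hAn : A.Nonempty := by
    refine ⟨_, ∅, ⟨fun i => absurd i.2 (Finset.notMem_empty _),
      fun i => absurd i.2 (Finset.notMem_empty _)⟩, rfl⟩
  refine isClosed_setOfPred_isCompactOperator.closure_subset (Metric.mem_closure_iff.2 fun ε hε => ?_)
  -- A finite orthonormal family is chosen with nearly maximal sum. Adjoining a unit vector
  -- orthogonal to it cannot exceed the supremum, so `T` has norm at most `ε / 2` on the orthogonal
  -- complement, and `T` composed with the finite-rank projection is within `ε`.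
  obtain ⟨_, ⟨s, hs, rfl⟩, hlt⟩ := exists_lt_of_lt_csSup hAn
    (show sSup A - (ε / 2) ^ 2 < sSup A by linarith [pow_pos (half_pos hε) 2])
  have hperp : ∀ v : E, (∀ e ∈ s, ⟪e, v⟫ = 0) → ‖T v‖ ≤ ε / 2 * ‖v‖ := by
    have hunit : ∀ v : E, ‖v‖ = 1 → (∀ e ∈ s, ⟪e, v⟫ = 0) → ‖T v‖ ≤ ε / 2 := by
      intro v hv hvs
      have hmem : v ∉ s := fun h => by
        have := hvs v h
        rw [real_inner_self_eq_norm_sq, hv] at this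
        norm_num at this
      have h1 := le_csSup hAb ⟨insert v s, orthonormal_insert hs hv hvs, rfl⟩
      rw [Finset.sum_insert hmem] at h1
      exact le_of_sq_le_sq (by linarith) (half_pos hε).le
    intro v hvs
    rcases eq_or_ne v 0 with rfl | hv
    · simp
    have hv0 : 0 < ‖v‖ := norm_pos_iff.2 hv
    have h1 := hunit (‖v‖⁻¹ • v) (by rw [norm_smul, norm_inv, norm_norm, inv_mul_cancel₀ hv0.ne'])
      fun e he => by rw [real_inner_smul_right, hvs e he, mul_zero]
    rw [map_smul, norm_smul, norm_inv, norm_norm, inv_mul_le_iff₀ hv0] at h1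
    linarith
  set V : Submodule ℝ E := Submodule.span ℝ (s : Set E) with hV
  have : FiniteDimensional ℝ V := FiniteDimensional.span_finset ℝ s
  refine ⟨T ∘L V.starProjection, ?_, ?_⟩
  · have h1 : IsCompactOperator (T ∘L V.subtypeL) := isCompactOperator_of_locallyCompactSpace_rng _
    exact h1.comp_clm V.orthogonalProjectionOnto
  · rw [dist_eq_norm]
    refine lt_of_le_of_lt (ContinuousLinearMap.opNorm_le_bound _ (half_pos hε).le fun x => ?_)
      (half_lt_self hε)
    have h1 : (T - T ∘L V.starProjection) x = T (x - V.starProjection x) := by simp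
    have h2 : x - V.starProjection x ∈ Vᗮ := V.sub_starProjection_mem_orthogonal x
    rw [h1]
    refine (hperp _ fun e he => ?_).trans ?_
    · exact (Submodule.mem_orthogonal _ _).1 h2 e (Submodule.subset_span he)
    · gcongr
      have h3 := V.norm_sq_eq_add_norm_sq_starProjection x
      have h4 : Vᗮ.starProjection x = x - V.starProjection x := by
        simp [Submodule.starProjection_orthogonal]
      rw [h4] at h3
      exact le_of_sq_le_sq (by nlinarith [sq_nonneg ‖V.starProjection x‖]) (norm_nonneg _)

end HilbertSchmidtNorm

/-! ### Positive operators and their inverses. -/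

section PositiveOperators

variable {E : Type*} [NormedAddCommGroup E] [InnerProductSpace ℝ E]

/-- This is `B² ≤ M B` for `0 ≤ B ≤ M`, from positivity of `B` at `u - M⁻¹ B u`. For `M = 0` the
vectors `u - t B u` with large `t` replace it. -/
lemma norm_sq_le_mul_inner {B : E →L[ℝ] E} (hs : ∀ u v, ⟪B u, v⟫ = ⟪u, B v⟫)
    (hp : ∀ u, 0 ≤ ⟪B u, u⟫) {M : ℝ} (hM : ∀ u, ⟪B u, u⟫ ≤ M * ‖u‖ ^ 2) (u : E) :
    ‖B u‖ ^ 2 ≤ M * ⟪B u, u⟫ := by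
  rcases eq_or_ne (B u) 0 with h0 | h0
  · simp [h0]
  have hn : 0 < ‖B u‖ ^ 2 := by positivity
  have hM0 : 0 ≤ M := by
    by_contra! hlt
    have h1 := (hp (B u)).trans (hM (B u))
    nlinarith
  rcases hM0.eq_or_lt with h | hM0
  · have hd : ∀ t : ℝ, 0 ≤ ⟪B u, u⟫ - 2 * t * ‖B u‖ ^ 2 := fun t => by
      have h1 := hp (u - t • B u)
      have h2 : ⟪B (B u), B u⟫ = 0 := le_antisymm (by simpa [← h] using hM (B u)) (hp _)
      rw [map_sub, map_smul, inner_sub_left, inner_sub_right, inner_sub_right,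
        real_inner_smul_left, real_inner_smul_left, real_inner_smul_right, real_inner_smul_right,
        hs (B u) u, real_inner_self_eq_norm_sq, h2] at h1
      linarith
    have h3 := hd ((⟪B u, u⟫ + 1) / (2 * ‖B u‖ ^ 2))
    have h4 : 2 * ((⟪B u, u⟫ + 1) / (2 * ‖B u‖ ^ 2)) * ‖B u‖ ^ 2 = ⟪B u, u⟫ + 1 := by
      field_simp
    linarith
  · have h1 := hp (u - M⁻¹ • B u)
    have h2 := hM (B u)
    rw [map_sub, map_smul, inner_sub_left, inner_sub_right, inner_sub_right,
      real_inner_smul_left, real_inner_smul_left, real_inner_smul_right, real_inner_smul_right,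
      hs (B u) u, real_inner_self_eq_norm_sq] at h1
    have h3 : M⁻¹ * (M⁻¹ * ⟪B (B u), B u⟫) ≤ M⁻¹ * ‖B u‖ ^ 2 := by
      have : M⁻¹ * ⟪B (B u), B u⟫ ≤ ‖B u‖ ^ 2 := by
        rw [inv_mul_le_iff₀ hM0]; exact h2
      gcongr
    have h5 : M⁻¹ * ‖B u‖ ^ 2 ≤ ⟪B u, u⟫ := by linarith
    rwa [inv_mul_le_iff₀ hM0] at h5

lemma opNorm_le_of_inner_le {B : E →L[ℝ] E} (hs : ∀ u v, ⟪B u, v⟫ = ⟪u, B v⟫)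
    (hp : ∀ u, 0 ≤ ⟪B u, u⟫) {M : ℝ} (hM0 : 0 ≤ M) (hM : ∀ u, ⟪B u, u⟫ ≤ M * ‖u‖ ^ 2) :
    ‖B‖ ≤ M := by
  refine B.opNorm_le_bound hM0 fun u => le_of_sq_le_sq ?_ (by positivity)
  calc ‖B u‖ ^ 2 ≤ M * ⟪B u, u⟫ := norm_sq_le_mul_inner hs hp hM u
    _ ≤ M * (M * ‖u‖ ^ 2) := by gcongr; exact hM u
    _ = _ := by ring

lemma inner_apply_self_le (B : E →L[ℝ] E) {M : ℝ} (hB : ‖B‖ ≤ M) (u : E) :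
    ⟪B u, u⟫ ≤ M * ‖u‖ ^ 2 := by
  refine (real_inner_le_norm _ _).trans ?_
  rw [pow_two, ← mul_assoc]
  gcongr
  exact B.le_of_opNorm_le hB u

/-- A strictly positive compact perturbation of the identity is invertible and coercive. -/
theorem exists_inverse_of_isCompactOperator_sub_one [CompleteSpace E] {P : E →L[ℝ] E}
    (hc : IsCompactOperator (P - (1 : E →L[ℝ] E))) (hpos : ∀ u, u ≠ 0 → 0 < ⟪P u, u⟫) :
    ∃ B : E →L[ℝ] E, (∀ u, P (B u) = u) ∧ ∀ u, B (P u) = u := by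
  -- Fredholm alternative: if `-1` were in the spectrum of the compact operator `P - 1` it would be
  -- an eigenvalue, with eigenvector in the kernel of `P`.
  have h1 : (-1 : ℝ) ∉ spectrum ℝ (P - (1 : E →L[ℝ] E)) := by
    intro h
    obtain ⟨u, hu, hu0⟩ := ((hc.hasEigenvalue_iff_mem_spectrum (by norm_num)).2 h).exists_hasEigenvector
    have h2 : (P - (1 : E →L[ℝ] E)) u = (-1 : ℝ) • u := Module.End.mem_eigenspace_iff.1 hu
    have h3 : P u = 0 := by
      have h4 : P u - u = -u := by simpa using h2
      simpa using h4
    have := hpos u hu0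
    rw [h3, inner_zero_left] at this
    exact lt_irrefl _ this
  have h2 : IsUnit P := by
    rw [spectrum.notMem_iff] at h1
    have : algebraMap ℝ (E →L[ℝ] E) (-1) - (P - (1 : E →L[ℝ] E)) = -P := by
      rw [map_neg, map_one]; abel
    rw [this] at h1
    exact (IsUnit.neg_iff P).1 h1
  obtain ⟨U, rfl⟩ := h2
  refine ⟨(↑U⁻¹ : E →L[ℝ] E), fun u => ?_, fun u => ?_⟩
  · exact DFunLike.congr_fun U.mul_inv u
  · exact DFunLike.congr_fun U.inv_mul u

end PositiveOperators

/-! ### Hilbert bases inside a dense range, and bounds by finite sections. -/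

section HilbertBasisBounds

variable {E H : Type*} [NormedAddCommGroup E] [InnerProductSpace ℝ E] [CompleteSpace E]
  [NormedAddCommGroup H] [InnerProductSpace ℝ H]

/-- Covariances are only known on the range of `J†`, so the basis must consist of vectors `J† y`.
Gram–Schmidt applied to the image of a dense sequence stays in the range. -/
lemma exists_hilbertBasis_mem_range [SecondCountableTopology H] (L : H →L[ℝ] E)
    (hL : DenseRange L) :
    ∃ (ι : Type) (b : HilbertBasis ι ℝ E), ∀ i, ∃ y, L y = b i := by
  set f : ℕ → E := fun n => L (TopologicalSpace.denseSeq H n) with hf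
  set g := fun i : {i | InnerProductSpace.gramSchmidtNormed ℝ f i ≠ 0} =>
    InnerProductSpace.gramSchmidtNormed ℝ f i with hg
  have hgo : Orthonormal ℝ g := InnerProductSpace.gramSchmidtNormed_orthonormal' f
  have hspan : Submodule.span ℝ (Set.range g) = Submodule.span ℝ (Set.range f) := by
    rw [← InnerProductSpace.span_gramSchmidt ℝ f, ← InnerProductSpace.span_gramSchmidtNormed_range]
    refine le_antisymm (Submodule.span_mono ?_) (Submodule.span_le.2 ?_)
    · rintro _ ⟨i, rfl⟩; exact ⟨i, rfl⟩
    · rintro _ ⟨i, rfl⟩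
      by_cases h : InnerProductSpace.gramSchmidtNormed ℝ f i = 0
      · rw [h]; exact Submodule.zero_mem _
      · exact Submodule.subset_span ⟨⟨i, h⟩, rfl⟩
  have hdense : ⊤ ≤ (Submodule.span ℝ (Set.range g)).topologicalClosure := by
    rw [hspan]
    intro x _
    have hd : DenseRange f := hL.comp (TopologicalSpace.denseRange_denseSeq H) L.continuous
    exact closure_mono Submodule.subset_span (hd x)
  refine ⟨_, HilbertBasis.mk hgo hdense, fun i => ?_⟩
  rw [HilbertBasis.coe_mk]
  have h1 : g i ∈ Submodule.span ℝ (Set.range f) := hspan ▸ Submodule.subset_span ⟨i, rfl⟩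
  have h2 : Submodule.span ℝ (Set.range f) ≤ LinearMap.range (L : H →ₗ[ℝ] E) := by
    rw [Submodule.span_le]
    rintro _ ⟨n, rfl⟩
    exact ⟨_, rfl⟩
  exact h2 h1

variable {ι : Type*} (b : HilbertBasis ι ℝ E)

omit [CompleteSpace E] in
lemma tendsto_sum_inner_sq (x : E) :
    Tendsto (fun G : Finset ι => ∑ j ∈ G, ⟪x, b j⟫ ^ 2) atTop (𝓝 (‖x‖ ^ 2)) := by
  have h := b.hasSum_inner_mul_inner x x
  rw [real_inner_self_eq_norm_sq] at h
  refine h.congr fun G => ?_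
  refine Finset.sum_congr rfl fun j _ => ?_
  simp only [real_inner_comm x, pow_two]

omit [CompleteSpace E] in
lemma sum_norm_sq_le_of_sections {D : E →L[ℝ] E} {K : ℝ}
    (h : ∀ G : Finset ι, ∑ i ∈ G, ∑ j ∈ G, ⟪D (b i), b j⟫ ^ 2 ≤ K) (G : Finset ι) :
    ∑ i ∈ G, ‖D (b i)‖ ^ 2 ≤ K := by
  classical
  have hlim : Tendsto (fun G' : Finset ι => ∑ i ∈ G, ∑ j ∈ G', ⟪D (b i), b j⟫ ^ 2) atTop
      (𝓝 (∑ i ∈ G, ‖D (b i)‖ ^ 2)) :=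
    tendsto_finsetSum _ fun i _ => tendsto_sum_inner_sq b _
  refine le_of_tendsto hlim ?_
  filter_upwards [eventually_ge_atTop G] with G' hG'
  refine le_trans ?_ (h G')
  exact Finset.sum_le_sum_of_subset_of_nonneg hG' fun i _ _ =>
    Finset.sum_nonneg fun j _ => sq_nonneg _

omit [CompleteSpace E] in
/-- Bound for the Hilbert–Schmidt norm of `P D P'` from the finite sections of `D`. -/
theorem sum_norm_sq_comp_le {D P P' : E →L[ℝ] E} {K M : ℝ}
    (hD : ∀ u v, ⟪D u, v⟫ = ⟪u, D v⟫) (hP' : ∀ u v, ⟪P' u, v⟫ = ⟪u, P' v⟫)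
    (hPM : ‖P‖ ≤ M) (hPM' : ‖P'‖ ≤ M)
    (h : ∀ G : Finset ι, ∑ i ∈ G, ∑ j ∈ G, ⟪D (b i), b j⟫ ^ 2 ≤ K)
    {s : Finset E} (hs : Orthonormal ℝ ((↑) : s → E)) :
    ∑ e ∈ s, ‖P (D (P' e))‖ ^ 2 ≤ M ^ 4 * K := by
  have hlim : Tendsto (fun G : Finset ι => ∑ e ∈ s, ∑ j ∈ G, ⟪D (P' e), b j⟫ ^ 2) atTop
      (𝓝 (∑ e ∈ s, ‖D (P' e)‖ ^ 2)) :=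
    tendsto_finsetSum _ fun e _ => tendsto_sum_inner_sq b _
  have h1 : ∑ e ∈ s, ‖D (P' e)‖ ^ 2 ≤ M ^ 2 * K := by
    refine le_of_tendsto' hlim fun G => ?_
    rw [Finset.sum_comm]
    -- Moving `D` and `P'` to the basis side exchanges the two orthonormal families, so Bessel's
    -- inequality applies to the family `s`.
    calc ∑ j ∈ G, ∑ e ∈ s, ⟪D (P' e), b j⟫ ^ 2
        = ∑ j ∈ G, ∑ e : s, ‖⟪(e : E), P' (D (b j))⟫‖ ^ 2 := by
          refine Finset.sum_congr rfl fun j _ => ?_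
          rw [← Finset.sum_coe_sort s]
          refine Finset.sum_congr rfl fun e _ => ?_
          rw [hD, hP', Real.norm_eq_abs, sq_abs]
      _ ≤ ∑ j ∈ G, ‖P' (D (b j))‖ ^ 2 :=
          Finset.sum_le_sum fun j _ => hs.sum_inner_products_le _
      _ ≤ ∑ j ∈ G, M ^ 2 * ‖D (b j)‖ ^ 2 := by
          refine Finset.sum_le_sum fun j _ => ?_
          rw [← mul_pow]
          exact pow_le_pow_left₀ (norm_nonneg _) (P'.le_of_opNorm_le hPM' _) 2
      _ ≤ M ^ 2 * K := by
          rw [← Finset.mul_sum]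
          gcongr
          exact sum_norm_sq_le_of_sections b h G
  calc ∑ e ∈ s, ‖P (D (P' e))‖ ^ 2 ≤ ∑ e ∈ s, M ^ 2 * ‖D (P' e)‖ ^ 2 := by
        refine Finset.sum_le_sum fun e _ => ?_
        rw [← mul_pow]
        exact pow_le_pow_left₀ (norm_nonneg _) (P.le_of_opNorm_le hPM _) 2
    _ ≤ M ^ 2 * (M ^ 2 * K) := by rw [← Finset.mul_sum]; gcongr
    _ = _ := by ring

/-- A vector `a` with `⟪y, a⟫² ≤ K ‖J† y‖²` for all `y` lies in the image of `J`. -/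
theorem exists_apply_eq_of_inner_sq_le [CompleteSpace H] (J : E →L[ℝ] H)
    (hJ : DenseRange (ContinuousLinearMap.adjoint J)) {a : H} {K : ℝ} (hK : 0 ≤ K)
    (h : ∀ y, ⟪y, a⟫ ^ 2 ≤ K ^ 2 * ‖ContinuousLinearMap.adjoint J y‖ ^ 2) :
    ∃ v : E, J v = a ∧ ‖v‖ ≤ K := by
  set f : H →ₗ[ℝ] ℝ := (innerSL ℝ a).toLinearMap with hf
  have hfb : ∀ y, ‖f y‖ ≤ K * ‖(ContinuousLinearMap.adjoint J : H →ₗ[ℝ] E) y‖ := fun y => by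
    refine le_of_sq_le_sq ?_ (by positivity)
    rw [mul_pow, Real.norm_eq_abs, sq_abs]
    have : f y = ⟪y, a⟫ := real_inner_comm _ _
    rw [this]
    exact h y
  -- The bound makes `y ↦ ⟪a, y⟫` factor through `J†`; it extends from the dense range to `E`, and
  -- the Riesz vector of the extension is the preimage of `a`.
  set g : E →L[ℝ] ℝ := f.extendOfNorm (ContinuousLinearMap.adjoint J : H →ₗ[ℝ] E) with hg
  set v : E := (InnerProductSpace.toDual ℝ E).symm g with hv
  have hvi : ∀ u, ⟪v, u⟫ = g u := fun u => InnerProductSpace.toDual_symm_apply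
  refine ⟨v, ext_inner_right ℝ fun y => ?_, ?_⟩
  · rw [← ContinuousLinearMap.adjoint_inner_right, hvi]
    exact LinearMap.extendOfNorm_eq hJ ⟨K, hfb⟩ y
  · have h1 : ‖g v‖ ≤ K * ‖v‖ := LinearMap.norm_extendOfNorm_apply_le hJ K hfb v
    rw [← hvi, real_inner_self_eq_norm_sq, Real.norm_of_nonneg (sq_nonneg _)] at h1
    nlinarith [norm_nonneg v, sq_nonneg (‖v‖ - K)]

lemma denseRange_adjoint [CompleteSpace H] {J : E →L[ℝ] H} (hJ : Function.Injective J) :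
    DenseRange (ContinuousLinearMap.adjoint J) := by
  have h1 : (ContinuousLinearMap.adjoint J).rangeᗮ = ⊥ := by
    rw [ContinuousLinearMap.orthogonal_range, ContinuousLinearMap.adjoint_adjoint]
    exact LinearMap.ker_eq_bot.2 hJ
  have h2 := (Submodule.topologicalClosure_eq_top_iff).2 h1
  exact (Submodule.dense_iff_topologicalClosure_eq_top).2 h2

end HilbertBasisBounds

/-! ### Convergence of means and precisions along Hellinger Cauchy sequences. -/

section PrecisionSequences

variable {E H : Type*} [NormedAddCommGroup E] [InnerProductSpace ℝ E] [CompleteSpace E]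
  [NormedAddCommGroup H] [InnerProductSpace ℝ H] [CompleteSpace H] [MeasurableSpace H]

/-- A sequence of Gaussian measures on `H` with covariances `J P⁻¹ J†`, where `J : E → H` is
injective and `P` is symmetric and positive, which is Cauchy for the Hellinger distance. -/
structure HellingerCauchy [BorelSpace H] (J : E →L[ℝ] H) (μ : Measure H) (ν : ℕ → Measure H)
    (P B : ℕ → E →L[ℝ] E) : Prop where
  injective : Function.Injective J
  gaussian : ∀ n, IsGaussian (ν n)
  symm : ∀ n u v, ⟪P n u, v⟫ = ⟪u, P n v⟫
  nonneg : ∀ n u, 0 ≤ ⟪P n u, u⟫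
  apply_inv : ∀ n u, P n (B n u) = u
  inv_apply : ∀ n u, B n (P n u) = u
  cov : ∀ n y y', covarianceBilin (ν n) y y'
    = ⟪B n (ContinuousLinearMap.adjoint J y), ContinuousLinearMap.adjoint J y'⟫
  ac : ∀ n, ν n ≪ μ
  cauchy : ∀ ε : ℝ, 0 < ε → ∃ N, ∀ n ≥ N, ∀ k ≥ N, hellingerSq μ (ν n) (ν k) ≤ ε

namespace HellingerCauchy

variable [BorelSpace H] {J : E →L[ℝ] H} {μ : Measure H} {ν : ℕ → Measure H} {P B : ℕ → E →L[ℝ] E}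
  (h : HellingerCauchy J μ ν P B)

include h

lemma inv_symm (n : ℕ) (u v : E) : ⟪B n u, v⟫ = ⟪u, B n v⟫ := by
  conv_lhs => rw [← h.apply_inv n v]
  conv_rhs => rw [← h.apply_inv n u]
  rw [h.symm]

lemma inv_nonneg (n : ℕ) (u : E) : 0 ≤ ⟪B n u, u⟫ := by
  have := h.nonneg n (B n u)
  rwa [h.apply_inv, real_inner_comm] at this

lemma norm_sq_le {n : ℕ} {M : ℝ} (hB : ‖B n‖ ≤ M) (w : E) : ‖w‖ ^ 2 ≤ M * ⟪P n w, w⟫ := by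
  have := norm_sq_le_mul_inner (h.inv_symm n) (h.inv_nonneg n) (inner_apply_self_le _ hB) (P n w)
  rwa [h.inv_apply, real_inner_comm] at this

variable [SecondCountableTopology H] [IsFiniteMeasure μ]

/-- The comparison of variances gives this on the range of `J†`, which is dense. -/
lemma inner_inv_le {n k : ℕ} (hH : hellingerSq μ (ν n) (ν k) ≤ 1 / 1000) (z : E) :
    ⟪B k z, z⟫ ≤ 2 * ⟪B n z, z⟫ := by
  have := h.gaussian n
  have := h.gaussian k
  refine (denseRange_adjoint h.injective).induction_on (p := fun z => ⟪B k z, z⟫ ≤ 2 * ⟪B n z, z⟫)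
    z (isClosed_le (by fun_prop) (by fun_prop)) fun y => ?_
  rw [← h.cov, ← h.cov]
  exact covarianceBilin_le_two_mul (h.ac n) (h.ac k) hH y

/-- Past some `N` every `B n` lies between `B N / 2` and `2 B N` as a form, and `B N` is bounded
with bounded inverse. -/
theorem exists_bound : ∃ (N : ℕ) (M : ℝ), 0 < M ∧ (∀ n ≥ N, ‖B n‖ ≤ M) ∧ (∀ n ≥ N, ‖P n‖ ≤ M) ∧
    ∀ n ≥ N, ∀ k ≥ N, hellingerSq μ (ν n) (ν k) ≤ 1 / 1000 := by
  obtain ⟨N, hN⟩ := h.cauchy (1 / 1000) (by norm_num)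
  set L : ℝ := ‖P N‖ ^ 2 * (‖B N‖ * 2) with hL
  have hL0 : 0 ≤ L := by positivity
  refine ⟨N, 2 * ‖B N‖ + L + 1, by positivity, fun n hn => ?_, fun n hn => ?_, hN⟩
  · have : ‖B n‖ ≤ 2 * ‖B N‖ := opNorm_le_of_inner_le (h.inv_symm n) (h.inv_nonneg n)
      (by positivity) fun u => (h.inner_inv_le (hN N le_rfl n hn) u).trans (by
        rw [mul_assoc]; gcongr; exact inner_apply_self_le _ le_rfl u)
    linarith
  · have h1 : ∀ z, ‖z‖ ^ 2 ≤ L * ⟪B n z, z⟫ := fun z => by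
      have e1 : ‖z‖ ≤ ‖P N‖ * ‖B N z‖ := by
        conv_lhs => rw [← h.apply_inv N z]
        exact (P N).le_opNorm _
      have e2 := norm_sq_le_mul_inner (h.inv_symm N) (h.inv_nonneg N)
        (inner_apply_self_le _ le_rfl) z
      have e3 := h.inner_inv_le (hN n hn N le_rfl) z
      calc ‖z‖ ^ 2 ≤ (‖P N‖ * ‖B N z‖) ^ 2 := by gcongr
        _ = ‖P N‖ ^ 2 * ‖B N z‖ ^ 2 := mul_pow _ _ _
        _ ≤ ‖P N‖ ^ 2 * (‖B N‖ * (2 * ⟪B n z, z⟫)) := by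
          gcongr; exact e2.trans (by gcongr)
        _ = L * ⟪B n z, z⟫ := by rw [hL]; ring
    have h2 : ‖P n‖ ≤ L := by
      refine (P n).opNorm_le_bound hL0 fun w => ?_
      have e1 := h1 (P n w)
      rw [h.inv_apply] at e1
      rcases eq_or_ne (P n w) 0 with h0 | h0
      · rw [h0, norm_zero]; positivity
      · have e2 : 0 < ‖P n w‖ := norm_pos_iff.2 h0
        refine le_of_mul_le_mul_right ?_ e2
        calc ‖P n w‖ * ‖P n w‖ = ‖P n w‖ ^ 2 := (pow_two _).symm
          _ ≤ L * ⟪w, P n w⟫ := e1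
          _ ≤ L * (‖w‖ * ‖P n w‖) := by gcongr; exact real_inner_le_norm _ _
          _ = _ := by ring
    have := norm_nonneg (B N)
    linarith

/-- The precision operators form a Cauchy sequence in the Hilbert–Schmidt norm. -/
theorem sum_sq_precision_sub_le {ε : ℝ} (hε : 0 < ε) :
    ∃ N, ∀ n ≥ N, ∀ k ≥ N, ∀ s : Finset E, Orthonormal ℝ ((↑) : s → E) →
      ∑ e ∈ s, ‖(P n - P k) e‖ ^ 2 ≤ ε ^ 2 := by
  obtain ⟨N₁, M, hM, hB, hP, hH⟩ := h.exists_bound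
  -- The covariance estimate contributes `64 M²`; the two precision factors contribute `M⁴`.
  obtain ⟨N₂, hN₂⟩ := h.cauchy (ε ^ 2 / (64 * M ^ 6)) (by positivity)
  obtain ⟨ι, b, hb⟩ := exists_hilbertBasis_mem_range (ContinuousLinearMap.adjoint J)
    (denseRange_adjoint h.injective)
  choose y hy using hb
  refine ⟨max N₁ N₂, fun n hn k hk s hs => ?_⟩
  have hn₁ := (le_max_left _ _).trans hn
  have hn₂ := (le_max_right _ _).trans hn
  have hk₁ := (le_max_left _ _).trans hk
  have hk₂ := (le_max_right _ _).trans hk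
  have := h.gaussian n
  have := h.gaussian k
  set t := hellingerSq μ (ν n) (ν k) with ht
  have hsec : ∀ G : Finset ι, ∑ i ∈ G, ∑ j ∈ G, ⟪(B k - B n) (b i), b j⟫ ^ 2 ≤ 64 * t * M ^ 2 := by
    intro G
    have h1 := sum_sq_covariance_sub_le (ι := G) (y := fun i => y i) (z := fun i => b i)
      (h.ac n) (h.ac k) (hH n hn₁ k hk₁) (b.orthonormal.comp _ Subtype.val_injective)
      (hB n hn₁) (hB k hk₁) (fun i j => by rw [h.cov, hy, hy]) (fun i j => by rw [h.cov, hy, hy])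
    rw [← Finset.sum_coe_sort G]
    simp_rw [← Finset.sum_coe_sort G (fun j => ⟪(B k - B n) (b _), b j⟫ ^ 2)]
    exact h1
  have h2 := sum_norm_sq_comp_le b (D := B k - B n) (P := P n) (P' := P k) (M := M)
    (fun u v => by
      simp only [sub_apply, inner_sub_left, inner_sub_right, h.inv_symm])
    (h.symm k) (hP n hn₁) (hP k hk₁) hsec hs
  -- The resolvent identity carries the estimate from the inverses to the precisions.
  have h3 : ∀ e, (P n - P k) e = P n ((B k - B n) (P k e)) := fun e => by
    simp only [sub_apply, map_sub, h.inv_apply, h.apply_inv]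
  simp_rw [h3]
  refine h2.trans ?_
  have h4 := hN₂ n hn₂ k hk₂
  rw [le_div_iff₀ (by positivity)] at h4
  calc M ^ 4 * (64 * t * M ^ 2) = t * (64 * M ^ 6) := by ring
    _ ≤ _ := h4

/-- The squared pairing of a mean difference with `y` is at most a small multiple of `‖J† y‖²`, so
the difference has a small preimage under `J`. -/
lemma exists_mean_sub {ε : ℝ} (hε : 0 < ε) :
    ∃ N, ∀ n ≥ N, ∀ k ≥ N, ∃ v : E, J v = (∫ x, x ∂(ν k)) - ∫ x, x ∂(ν n) ∧ ‖v‖ ≤ ε := by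
  obtain ⟨N₁, M, hM, hB, hP, hH⟩ := h.exists_bound
  obtain ⟨N₂, hN₂⟩ := h.cauchy (ε ^ 2 / (8 * M)) (by positivity)
  refine ⟨max N₁ N₂, fun n hn k hk => ?_⟩
  have hn₁ := (le_max_left _ _).trans hn
  have hn₂ := (le_max_right _ _).trans hn
  have hk₁ := (le_max_left _ _).trans hk
  have hk₂ := (le_max_right _ _).trans hk
  have := h.gaussian n
  have := h.gaussian k
  refine exists_apply_eq_of_inner_sq_le J (denseRange_adjoint h.injective) hε.le fun y => ?_
  have h1 := sq_inner_mean_sub_le (h.ac n) (h.ac k) ((hH n hn₁ k hk₁).trans (by norm_num)) y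
  rw [h.cov, h.cov] at h1
  have h2 := inner_apply_self_le _ (hB n hn₁) (ContinuousLinearMap.adjoint J y)
  have h3 := inner_apply_self_le _ (hB k hk₁) (ContinuousLinearMap.adjoint J y)
  have h4 := hN₂ n hn₂ k hk₂
  rw [le_div_iff₀ (by positivity)] at h4
  have h5 : 0 ≤ hellingerSq μ (ν n) (ν k) := hellingerSq_nonneg
  refine h1.trans ?_
  calc _ ≤ 4 * hellingerSq μ (ν n) (ν k) * (M * ‖ContinuousLinearMap.adjoint J y‖ ^ 2
        + M * ‖ContinuousLinearMap.adjoint J y‖ ^ 2) := by gcongr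
    _ = hellingerSq μ (ν n) (ν k) * (8 * M) * ‖ContinuousLinearMap.adjoint J y‖ ^ 2 := by ring
    _ ≤ _ := by gcongr

/-- The means converge in the norm of `E`. -/
theorem exists_mean_limit : ∃ (m : H) (v : ℕ → E),
    (∀ᶠ n in atTop, J (v n) = (∫ x, x ∂(ν n)) - m) ∧ Tendsto v atTop (𝓝 0) := by
  obtain ⟨N₀, hN₀⟩ := h.exists_mean_sub one_pos
  have hex : ∀ k, ∃ v : E, N₀ ≤ k → J v = (∫ x, x ∂(ν k)) - ∫ x, x ∂(ν N₀) := fun k => by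
    by_cases hk : N₀ ≤ k
    · obtain ⟨v, hv, -⟩ := hN₀ N₀ le_rfl k hk
      exact ⟨v, fun _ => hv⟩
    · exact ⟨0, fun h => absurd h hk⟩
  choose v hv using hex
  have hc : CauchySeq v := by
    refine Metric.cauchySeq_iff.2 fun ε hε => ?_
    obtain ⟨N, hN⟩ := h.exists_mean_sub (half_pos hε)
    refine ⟨max N₀ N, fun k hk n hn => ?_⟩
    obtain ⟨w, hw, hwε⟩ := hN n ((le_max_right _ _).trans hn) k ((le_max_right _ _).trans hk)
    have : v k - v n = w := h.injective (by
      rw [map_sub, hv k ((le_max_left _ _).trans hk), hv n ((le_max_left _ _).trans hn), hw]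
      abel)
    rw [dist_eq_norm, this]
    linarith
  obtain ⟨v₀, hv₀⟩ := cauchySeq_tendsto_of_complete hc
  refine ⟨(∫ x, x ∂(ν N₀)) + J v₀, fun n => v n - v₀, ?_, ?_⟩
  · filter_upwards [eventually_ge_atTop N₀] with n hn
    rw [map_sub, hv n hn]
    abel
  · simpa using hv₀.sub_const v₀

variable {P₀ B₀ : E →L[ℝ] E}

/-- The uniform bound on `B n` is a uniform lower bound on `P n`, and it survives the limit.
Pointwise limits of strictly positive forms could otherwise degenerate. -/
lemma exists_coercive_limit (hP₀ : Tendsto P atTop (𝓝 P₀)) :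
    ∃ M : ℝ, 0 < M ∧ ∀ w, ‖w‖ ^ 2 ≤ M * ⟪P₀ w, w⟫ := by
  obtain ⟨N, M, hM, hB, -, -⟩ := h.exists_bound
  refine ⟨M, hM, fun w => ?_⟩
  have hlim : Tendsto (fun n => M * ⟪P n w, w⟫) atTop (𝓝 (M * ⟪P₀ w, w⟫)) :=
    ((((ContinuousLinearMap.apply ℝ E w).continuous.tendsto _).comp hP₀).inner
      tendsto_const_nhds).const_mul M
  refine ge_of_tendsto hlim ?_
  filter_upwards [eventually_ge_atTop N] with n hn using h.norm_sq_le (hB n hn) w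

lemma tendsto_inv (hP₀ : Tendsto P atTop (𝓝 P₀)) (hB₀ : ∀ u, P₀ (B₀ u) = u) :
    Tendsto B atTop (𝓝 B₀) := by
  obtain ⟨N, M, hM, hB, -, -⟩ := h.exists_bound
  rw [tendsto_iff_norm_sub_tendsto_zero] at hP₀ ⊢
  have hlim : Tendsto (fun n => M * ‖P n - P₀‖ * ‖B₀‖) atTop (𝓝 0) := by
    simpa using (hP₀.const_mul M).mul_const ‖B₀‖
  refine squeeze_zero' (Eventually.of_forall fun n => norm_nonneg _) ?_ hlim
  filter_upwards [eventually_ge_atTop N] with n hn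
  have e : B n - B₀ = -(B n ∘L (P n - P₀) ∘L B₀) := by
    ext u
    simp [h.inv_apply, hB₀]
  rw [e, norm_neg]
  calc ‖B n ∘L (P n - P₀) ∘L B₀‖ ≤ ‖B n‖ * (‖P n - P₀‖ * ‖B₀‖) :=
        (ContinuousLinearMap.opNorm_comp_le _ _).trans (by
          gcongr; exact ContinuousLinearMap.opNorm_comp_le _ _)
    _ ≤ M * (‖P n - P₀‖ * ‖B₀‖) := by gcongr; exact hB n hn
    _ = _ := by ring

end HellingerCauchy

end PrecisionSequences

/-! ### Weak limits of Gaussian measures. -/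

section WeakLimit

variable {H : Type*} [NormedAddCommGroup H] [InnerProductSpace ℝ H] [CompleteSpace H]
  [SecondCountableTopology H] [MeasurableSpace H] [BorelSpace H]

/-- A weak limit of Gaussian measures with convergent means and covariances is Gaussian. -/
theorem isGaussianLaw_of_tendsto {ν : ℕ → ProbabilityMeasure H} {ν₀ : ProbabilityMeasure H}
    (hweak : Tendsto ν atTop (𝓝 ν₀)) (hν : ∀ n, IsGaussian (ν n : Measure H)) {m : H}
    (hm : Tendsto (fun n => ∫ x, x ∂(ν n : Measure H)) atTop (𝓝 m)) {C : H →L[ℝ] H}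
    (hC : ∀ y y', Tendsto (fun n => covarianceBilin (ν n : Measure H) y y') atTop
      (𝓝 ⟪y, C y'⟫)) :
    IsGaussianLaw (ν₀ : Measure H) m C := by
  have hsymm : ∀ y y', ⟪y, C y'⟫ = ⟪y', C y⟫ := fun y y' =>
    tendsto_nhds_unique (hC y y') ((hC y' y).congr fun n => covarianceBilin_comm _ _)
  set f : H →L[ℝ] H →L[ℝ] ℝ :=
    ((innerₗ H).comp (C : H →ₗ[ℝ] H)).mkContinuous₂ ‖C‖ fun u v => by
      refine (norm_inner_le_norm (𝕜 := ℝ) (C u) v).trans ?_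
      gcongr
      exact C.le_opNorm u with hf
  have hfa : ∀ u v, f u v = ⟪C u, v⟫ := fun u v => rfl
  have hpsd : f.toBilinForm.IsPosSemidef := by
    refine ⟨⟨fun x y => ?_⟩, ⟨fun x => ?_⟩⟩
    · change f x y = f y x
      rw [hfa, hfa, real_inner_comm, hsymm, real_inner_comm]
    · change 0 ≤ f x x
      rw [hfa, real_inner_comm]
      exact ge_of_tendsto' (hC x x) fun n => covarianceBilin_self_nonneg x
  -- Weak convergence gives pointwise convergence of characteristic functions, while the explicit
  -- Gaussian formula converges with the means and covariances.
  have hchar : ∀ t, charFun (ν₀ : Measure H) t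
      = Complex.exp (⟪t, m⟫ * Complex.I - f t t / 2) := by
    intro t
    have h1 : Tendsto (fun n => charFun (ν n : Measure H) t) atTop
        (𝓝 (charFun (ν₀ : Measure H) t)) := by
      rw [ProbabilityMeasure.tendsto_iff_forall_integral_rclike_tendsto ℂ] at hweak
      simp_rw [charFun_eq_integral_innerProbChar]
      exact hweak (BoundedContinuousFunction.innerProbChar t)
    refine tendsto_nhds_unique h1 ?_
    have h2 : ∀ n, charFun (ν n : Measure H) t
        = Complex.exp (⟪t, ∫ x, x ∂(ν n : Measure H)⟫ * Complex.I
          - covarianceBilin (ν n : Measure H) t t / 2) := fun n => by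
      have := hν n
      exact IsGaussian.charFun_eq' t
    simp_rw [h2]
    refine (Complex.continuous_exp.tendsto _).comp ?_
    refine Tendsto.sub (Tendsto.mul_const _ ?_) (Tendsto.div_const ?_ _)
    · exact (Complex.continuous_ofReal.tendsto _).comp (tendsto_const_nhds.inner hm)
    · rw [hfa, real_inner_comm]
      exact (Complex.continuous_ofReal.tendsto _).comp (hC t t)
  obtain ⟨h1, h2⟩ := gaussian_charFun_congr m f hpsd hchar
  refine ⟨isGaussian_iff_gaussian_charFun.2 ⟨m, f, hpsd, hchar⟩, h1.symm, fun y y' => ?_⟩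
  rw [← h2, hfa, hsymm, real_inner_comm]

end WeakLimit

/-! ### Riesz representation of operators into the dual. -/

section Riesz

lemma tendsto_norm_sub_zero {E F : Type*} [NormedAddCommGroup E] [NormedSpace ℝ E]
    [NormedAddCommGroup F] [NormedSpace ℝ F] {T : ℕ → E →L[ℝ] F} {T₀ : E →L[ℝ] F}
    (h : Tendsto T atTop (𝓝 T₀)) : Tendsto (fun n => ‖T n - T₀‖) atTop (𝓝 0) :=
  tendsto_iff_norm_sub_tendsto_zero.1 h

variable {E : Type*} [NormedAddCommGroup E] [InnerProductSpace ℝ E] [CompleteSpace E]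

/-- The operator `T` on `E` with `⟪T u, v⟫ = Γ u v`. -/
def rieszOp (Γ : E →L[ℝ] StrongDual ℝ E) : E →L[ℝ] E :=
  LinearMap.mkContinuous
    { toFun := fun u => (InnerProductSpace.toDual ℝ E).symm (Γ u)
      map_add' := fun u v => by simp
      map_smul' := fun r u => by simp } ‖Γ‖ fun u => by
    simpa using Γ.le_opNorm u

lemma inner_rieszOp (Γ : E →L[ℝ] StrongDual ℝ E) (u v : E) : ⟪rieszOp Γ u, v⟫ = Γ u v :=
  InnerProductSpace.toDual_symm_apply

lemma norm_rieszOp_apply (Γ : E →L[ℝ] StrongDual ℝ E) (u : E) : ‖rieszOp Γ u‖ = ‖Γ u‖ :=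
  (InnerProductSpace.toDual ℝ E).symm.norm_map (Γ u)

lemma rieszOp_sub (Γ Γ' : E →L[ℝ] StrongDual ℝ E) : rieszOp (Γ - Γ') = rieszOp Γ - rieszOp Γ' := by
  ext u
  refine ext_inner_right ℝ fun v => ?_
  simp [inner_rieszOp, inner_sub_left]

lemma norm_rieszOp_le (Γ : E →L[ℝ] StrongDual ℝ E) : ‖rieszOp Γ‖ ≤ ‖Γ‖ :=
  ContinuousLinearMap.opNorm_le_bound _ Γ.opNorm_nonneg fun u => by
    rw [norm_rieszOp_apply]; exact Γ.le_opNorm u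

lemma tendsto_rieszOp {Γ : ℕ → E →L[ℝ] StrongDual ℝ E} {Γ₀ : E →L[ℝ] StrongDual ℝ E}
    (h : Tendsto Γ atTop (𝓝 Γ₀)) : Tendsto (fun n => rieszOp (Γ n)) atTop (𝓝 (rieszOp Γ₀)) := by
  have h' : Tendsto (fun n => ‖Γ n - Γ₀‖) atTop (𝓝 0) := 
    tendsto_norm_sub_zero h
  refine tendsto_iff_norm_sub_tendsto_zero.2 (squeeze_zero (fun _ => norm_nonneg _) (fun n => ?_) h')
  rw [← rieszOp_sub]
  exact norm_rieszOp_le _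

lemma IsHilbertSchmidt.rieszOp {Γ : E →L[ℝ] StrongDual ℝ E} (h : IsHilbertSchmidt Γ) :
    IsHilbertSchmidt (rieszOp Γ) := by
  obtain ⟨K, hK, hs⟩ := h.exists_bound
  refine isHilbertSchmidt_of_bound hK ?_
  simpa only [norm_rieszOp_apply] using hs

end Riesz

variable {H : Type*} [NormedAddCommGroup H] [InnerProductSpace ℝ H] [CompleteSpace H]
  {C₀ : H →L[ℝ] H} {hC₀ : StrictlyPositive C₀}

namespace CameronMartin

instance : CompleteSpace (CameronMartin C₀ hC₀) :=
  let e : H ≃ₗᵢ[ℝ] CameronMartin C₀ hC₀ :=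
    ⟨sqrtEquiv, fun x => by rw [norm_def, LinearEquiv.symm_apply_apply]⟩
  (e.toIsometryEquiv.completeSpace_iff).1 inferInstance

theorem incl_injective : Function.Injective (incl : CameronMartin C₀ hC₀ →L[ℝ] H) :=
  Submodule.subtype_injective _

end CameronMartin

/-! ### The precision as an operator on the Cameron–Martin space. -/

section PrecisionOperator

variable {Γ : CameronMartin C₀ hC₀ →L[ℝ] CameronMartinDual C₀ hC₀}

/-- In the inner product of `H¹`, `C₀⁻¹` is the Riesz isomorphism itself, hence the identity after
representation. -/
lemma rieszOp_precision_sub_one : rieszOp (precision Γ) - (1 : _ →L[ℝ] _) = rieszOp Γ := by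
  ext u
  refine ext_inner_right ℝ fun v => ?_
  rw [sub_apply, inner_sub_left, inner_rieszOp, inner_rieszOp, precision, add_apply, add_apply,
    invCov_apply]
  simp

lemma rieszOp_precision (Γ : CameronMartin C₀ hC₀ →L[ℝ] CameronMartinDual C₀ hC₀) :
    rieszOp (precision Γ) = rieszOp Γ + 1 :=
  sub_eq_iff_eq_add.1 rieszOp_precision_sub_one

lemma precisionPos_iff : PrecisionPos Γ ↔
    (∀ u v, ⟪rieszOp (precision Γ) u, v⟫ = ⟪u, rieszOp (precision Γ) v⟫) ∧
      ∀ u, u ≠ 0 → 0 < ⟪rieszOp (precision Γ) u, u⟫ := by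
  refine and_congr (forall₂_congr fun u v => ?_) (forall₂_congr fun u _ => ?_)
  · rw [real_inner_comm _ u, inner_rieszOp, inner_rieszOp]
  · rw [inner_rieszOp]

lemma PrecisionPos.exists_inverse (h : PrecisionPos Γ) (hΓ : IsHilbertSchmidt Γ) :
    ∃ B : CameronMartin C₀ hC₀ →L[ℝ] CameronMartin C₀ hC₀,
      (∀ u, rieszOp (precision Γ) (B u) = u) ∧ ∀ u, B (rieszOp (precision Γ) u) = u := by
  refine exists_inverse_of_isCompactOperator_sub_one ?_ (precisionPos_iff.1 h).2
  rw [rieszOp_precision_sub_one]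
  exact hΓ.rieszOp.isCompactOperator

/-- If `B` inverts the precision operator on `H¹`, then `(C₀⁻¹ + Γ)⁻¹ = J B J†` on `H`. -/
lemma isPrecisionInverse_iff {B : CameronMartin C₀ hC₀ →L[ℝ] CameronMartin C₀ hC₀}
    (h1 : ∀ u, rieszOp (precision Γ) (B u) = u) (h2 : ∀ u, B (rieszOp (precision Γ) u) = u)
    (C : H →L[ℝ] H) : IsPrecisionInverse Γ C ↔
      ∀ x, C x = CameronMartin.incl (B (ContinuousLinearMap.adjoint CameronMartin.incl x)) := by
  have key : ∀ (u : CameronMartin C₀ hC₀) (x : H), precision Γ u = toDual x ↔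
      u = B (ContinuousLinearMap.adjoint CameronMartin.incl x) := by
    intro u x
    have e : precision Γ u = toDual x ↔
        rieszOp (precision Γ) u = ContinuousLinearMap.adjoint CameronMartin.incl x := by
      refine ⟨fun h => ext_inner_right ℝ fun v => ?_, fun h => ?_⟩
      · rw [inner_rieszOp, h, ContinuousLinearMap.adjoint_inner_left]; rfl
      · ext v
        rw [← inner_rieszOp, h, ContinuousLinearMap.adjoint_inner_left]; rfl
    rw [e]
    refine ⟨fun h => by rw [← h, h2], fun h => by rw [h, h1]⟩
  refine forall_congr' fun x => ?_
  simp only [key]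
  refine ⟨?_, fun h => ⟨_, h.symm, rfl⟩⟩
  rintro ⟨u, hu, rfl⟩
  exact hu.symm

end PrecisionOperator

lemma cameronMartinENorm_incl_le (u : CameronMartin C₀ hC₀) :
    cameronMartinENorm C₀ hC₀ (CameronMartin.incl u) ≤ ‖u‖ₑ :=
  iInf₂_le (f := fun (w : CameronMartin C₀ hC₀) (_ : CameronMartin.incl w = CameronMartin.incl u) =>
    ‖w‖ₑ) u rfl

/-! ### Exclusion of the Dirac case. -/

section NoAtoms

variable [SecondCountableTopology H] [MeasurableSpace H] [BorelSpace H]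

/-- A Gaussian measure that is not a Dirac mass has no atoms, and a Dirac mass has zero covariance,
against strict positivity of `C₀` on a nontrivial space. -/
lemma IsGaussianLaw.measure_singleton [Nontrivial H] {μ₀ : Measure H} {m₀ : H}
    (hμ₀ : IsGaussianLaw μ₀ m₀ C₀) (hC₀ : StrictlyPositive C₀) (x : H) : μ₀ {x} = 0 := by
  have := hμ₀.isGaussian
  have hne : ∀ x, μ₀ ≠ Measure.dirac x := by
    rintro x rfl
    obtain ⟨y, hy⟩ := exists_ne (0 : H)
    have h1 := hμ₀.covariance y y
    rw [covarianceBilin_self IsGaussian.memLp_two_id, variance_dirac, real_inner_comm] at h1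
    exact (hC₀.inner_pos y hy).ne h1
  have := IsGaussian.nullSingletonClass hne
  exact MeasureTheory.measure_singleton x

lemma precisionPos_of_absolutelyContinuous {μ₀ ν : Measure H} {m₀ m : H}
    (hμ₀ : IsGaussianLaw μ₀ m₀ C₀) {Γ : CameronMartin C₀ hC₀ →L[ℝ] CameronMartinDual C₀ hC₀}
    (hν : IsPrecisionGaussian ν m Γ) (hac : ν ≪ μ₀) : PrecisionPos Γ := by
  -- On the trivial space Dirac measures are not excluded by absolute continuity, but strict
  -- positivity is vacuous there.
  rcases subsingleton_or_nontrivial H with hH | hH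
  · have hs : Subsingleton (CameronMartin C₀ hC₀) := CameronMartin.incl_injective.subsingleton
    refine ⟨fun u v => by rw [Subsingleton.elim u v], fun u hu => absurd (Subsingleton.elim u 0) hu⟩
  · by_contra hn
    rw [hν.of_not_pos hn] at hac
    have := hac (hμ₀.measure_singleton hC₀ m)
    simp at this

end NoAtoms

end GaussianKL

end

/-! ### The convergence theorem. -/

open GaussianKL InformationTheory

theorem mainTheorem2
    {H : Type*} [NormedAddCommGroup H] [InnerProductSpace ℝ H] [CompleteSpace H]
    [SecondCountableTopology H] [MeasurableSpace H] [BorelSpace H]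
    (m₀ : H) (C₀ : H →L[ℝ] H) (hC₀ : GaussianKL.StrictlyPositive C₀)
    (μ₀ : Measure H) (hμ₀ : GaussianKL.IsGaussianLaw μ₀ m₀ C₀)
    {X : Type*} [NormedAddCommGroup X] [NormedSpace ℝ X] [CompleteSpace X]
    [SecondCountableTopology X]
    (ι : X →L[ℝ] H) (hι : Function.Injective ι)
    (hXmeas : MeasurableSet (Set.range ι)) (hXfull : μ₀ (Set.range ι) = 1)
    (Φ : X → ℝ) (hΦ : Continuous Φ) (hΦint : Integrable (GaussianKL.expNeg ι Φ) μ₀)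
    (m : ℕ → H)
    (Γ : ℕ → GaussianKL.CameronMartin C₀ hC₀ →L[ℝ] GaussianKL.CameronMartinDual C₀ hC₀)
    (hΓ : ∀ n, GaussianKL.IsHilbertSchmidt (Γ n))
    (ν : ℕ → ProbabilityMeasure H)
    (hν : ∀ n, GaussianKL.IsPrecisionGaussian (ν n : Measure H) (m n) (Γ n))
    (νs : ProbabilityMeasure H) (hweak : Tendsto ν atTop (𝓝 νs))
    (hfin : InformationTheory.klDiv (νs : Measure H) (GaussianKL.targetMeasure μ₀ ι Φ) ≠ ∞)
    (hKL : Tendsto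
      (fun n => InformationTheory.klDiv (ν n : Measure H) (GaussianKL.targetMeasure μ₀ ι Φ)) atTop
      (𝓝 (InformationTheory.klDiv (νs : Measure H) (GaussianKL.targetMeasure μ₀ ι Φ)))) :
    ∃ (ms : H)
      (Γs : GaussianKL.CameronMartin C₀ hC₀ →L[ℝ] GaussianKL.CameronMartinDual C₀ hC₀),
      GaussianKL.IsHilbertSchmidt Γs ∧
      GaussianKL.IsPrecisionGaussian (νs : Measure H) ms Γs ∧
      Tendsto
        (fun n => GaussianKL.cameronMartinENorm C₀ hC₀ (m n - ms)
          + GaussianKL.hsNorm (Γ n - Γs))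
        atTop (𝓝 0) := by
  set μ := targetMeasure μ₀ ι Φ with hμ
  have hμfin : IsFiniteMeasure μ := isFiniteMeasure_withDensity_ofReal (hΦint.const_mul _).2
  have hμac : μ ≪ μ₀ := withDensity_absolutelyContinuous _ _
  -- Early terms may have infinite divergence and be Dirac masses, so the argument runs on the
  -- shifted sequence.
  obtain ⟨N, hN⟩ := (hKL.eventually_ne hfin).exists_forall_of_atTop
  have hac : ∀ n, (ν (n + N) : Measure H) ≪ μ := fun n =>
    (klDiv_ne_top_iff.1 (hN _ (Nat.le_add_left N n))).1
  have hpos : ∀ n, PrecisionPos (Γ (n + N)) := fun n =>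
    precisionPos_of_absolutelyContinuous hμ₀ (hν _) ((hac n).trans hμac)
  choose B hPB hBP using fun n => (hpos n).exists_inverse (hΓ _)
  have hlaw : ∀ n, IsGaussianLaw (ν (n + N) : Measure H) (m (n + N))
      (CameronMartin.incl ∘L B n ∘L ContinuousLinearMap.adjoint CameronMartin.incl) := fun n => by
    obtain ⟨C, hC, hlaw⟩ := (hν (n + N)).of_pos (hpos n)
    have hCx := (isPrecisionInverse_iff (hPB n) (hBP n) C).1 hC
    have : C = CameronMartin.incl ∘L B n ∘L ContinuousLinearMap.adjoint CameronMartin.incl :=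
      ContinuousLinearMap.ext hCx
    rwa [← this]
  have hBsymm : ∀ n u v, ⟪B n u, v⟫ = ⟪u, B n v⟫ := fun n u v => by
    conv_lhs => rw [← hPB n v]
    conv_rhs => rw [← hPB n u]
    rw [(precisionPos_iff.1 (hpos n)).1]
  have hHC : HellingerCauchy CameronMartin.incl μ (fun n => (ν (n + N) : Measure H))
      (fun n => rieszOp (precision (Γ (n + N)))) B :=
    { injective := CameronMartin.incl_injective
      gaussian := fun n => (hlaw n).isGaussian
      symm := fun n => (precisionPos_iff.1 (hpos n)).1
      nonneg := fun n u => by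
        rcases eq_or_ne u 0 with rfl | hu
        · simp
        · exact ((precisionPos_iff.1 (hpos n)).2 u hu).le
      apply_inv := hPB
      inv_apply := hBP
      cov := fun n y y' => by
        rw [(hlaw n).covariance, hBsymm, ContinuousLinearMap.adjoint_inner_left]
        rfl
      ac := hac
      cauchy := fun ε hε => by
        obtain ⟨N', hN'⟩ := eventually_hellingerSq_le hweak hfin hKL hε
        exact ⟨N', fun n hn k hk => hN' _ (hn.trans (Nat.le_add_right n N)) _
          (hk.trans (Nat.le_add_right k N))⟩ }
  obtain ⟨Γs, hΓlim, hΓhs⟩ := exists_tendsto_hsNorm (T := fun n => Γ (n + N)) fun ε hε => by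
    obtain ⟨N', hN'⟩ := hHC.sum_sq_precision_sub_le hε
    refine ⟨N', fun n hn k hk s hs => ?_⟩
    refine le_of_eq_of_le (Finset.sum_congr rfl fun e _ => ?_) (hN' n hn k hk s hs)
    -- The identity cancels in differences of precisions, and the Riesz map is isometric, so the
    -- estimate for the precisions is one for `Γ`.
    rw [rieszOp_precision, rieszOp_precision, add_sub_add_right_eq_sub, ← rieszOp_sub,
      norm_rieszOp_apply]
  have hΓsHS : IsHilbertSchmidt Γs := by
    obtain ⟨n, hn⟩ := (hΓhs.eventually_lt_const ENNReal.zero_lt_top).exists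
    exact isHilbertSchmidt_of_hsNorm_sub_lt_top (hΓ _) hn
  have hPlim : Tendsto (fun n => rieszOp (precision (Γ (n + N)))) atTop
      (𝓝 (rieszOp (precision Γs))) := by
    simp_rw [rieszOp_precision]
    exact (tendsto_rieszOp hΓlim).add_const 1
  have hpos_s : PrecisionPos Γs := by
    obtain ⟨M, hM, hc⟩ := hHC.exists_coercive_limit hPlim
    refine precisionPos_iff.2 ⟨fun u v => ?_, fun u hu => ?_⟩
    · have hlim : ∀ u, Tendsto (fun n => rieszOp (precision (Γ (n + N))) u) atTop
          (𝓝 (rieszOp (precision Γs) u)) := fun u =>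
        ((ContinuousLinearMap.apply ℝ _ u).continuous.tendsto _).comp hPlim
      exact tendsto_nhds_unique ((hlim u).inner tendsto_const_nhds)
        ((tendsto_const_nhds.inner (hlim v)).congr fun n => (hHC.symm n u v).symm)
    · have h1 : 0 < ‖u‖ ^ 2 := by positivity
      exact pos_of_mul_pos_right (h1.trans_le (hc u)) hM.le
  obtain ⟨Bs, hPBs, hBPs⟩ := hpos_s.exists_inverse hΓsHS
  have hBlim := hHC.tendsto_inv hPlim hPBs
  obtain ⟨ms, v, hv, hv0⟩ := hHC.exists_mean_limit
  have hmean : ∀ n, ∫ x, x ∂(ν (n + N) : Measure H) = m (n + N) := fun n => (hlaw n).mean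
  have hmlim : Tendsto (fun n => ∫ x, x ∂(ν (n + N) : Measure H)) atTop (𝓝 ms) := by
    have h1 : Tendsto (fun n => (CameronMartin.incl (v n) : H) + ms) atTop (𝓝 ms) := by
      have := ((CameronMartin.incl (C := C₀) (hC := hC₀)).continuous.tendsto 0).comp hv0
      simpa using this.add_const ms
    refine h1.congr' ?_
    filter_upwards [hv] with n hn
    rw [hn, sub_add_cancel]
  have hlaw_s : IsGaussianLaw (νs : Measure H) ms
      (CameronMartin.incl ∘L Bs ∘L ContinuousLinearMap.adjoint CameronMartin.incl) := by
    refine isGaussianLaw_of_tendsto (hweak.comp (tendsto_add_atTop_nat N))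
      (fun n => (hlaw n).isGaussian) hmlim fun y y' => ?_
    have h1 : Tendsto (fun n => B n (ContinuousLinearMap.adjoint CameronMartin.incl y')) atTop
        (𝓝 (Bs (ContinuousLinearMap.adjoint CameronMartin.incl y'))) :=
      ((ContinuousLinearMap.apply ℝ _ _).continuous.tendsto _).comp hBlim
    have h2 := Tendsto.inner (𝕜 := ℝ) (tendsto_const_nhds (x := y))
      ((CameronMartin.incl.continuous.tendsto _).comp h1)
    exact h2.congr fun n => ((hlaw n).covariance y y').symm
  refine ⟨ms, Γs, hΓsHS, ⟨fun _ => ⟨_, (isPrecisionInverse_iff hPBs hBPs _).2 fun x => rfl, hlaw_s⟩,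
    fun h => absurd hpos_s h⟩, (tendsto_add_atTop_iff_nat N).1 ?_⟩
  have hmn : Tendsto (fun n => cameronMartinENorm C₀ hC₀ (m (n + N) - ms)) atTop (𝓝 0) := by
    have h1 : Tendsto (fun n => ‖v n‖ₑ) atTop (𝓝 0) := by simpa using hv0.enorm
    refine tendsto_of_tendsto_of_tendsto_of_le_of_le' tendsto_const_nhds h1
      (Eventually.of_forall fun _ => zero_le) ?_
    filter_upwards [hv] with n hn
    rw [← hmean, ← hn]
    exact cameronMartinENorm_incl_le _
  simpa using hmn.add hΓhs
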